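/- Let $-\infty<a<b<\infty$, let $p,q\in L^1([a,b],\mathbb R)$, let $\alpha\in[0,\pi)$, and put $$J=\begin{pmatrix}0&-1\\1&0\end{pmatrix},\qquad V(x)=\begin{pmatrix}p(x)&q(x)\\q(x)&-p(x)\end{pmatrix},\quad x\in[a,b].$$ Let $T$ be the Dirac–Krein operator in $L^2([a,b],\mathbb C^2)$ given by $T\boldsymbol f=-J\boldsymbol f'+V\boldsymbol f$ on the domain of all absolutely continuous $\boldsymbol f=(f\ \ \widehat f)^{\rm t}\in L^2([a,b],\mathbb C^2)$ with $-J\boldsymbol f'+V\boldsymbol f\in L^2([a,b],\mathbb C^2)$, $f(a)=0$ and $\cos\alpha\,f(b)+\sin\alpha\,\widehat f(b)=0$. Let $\rho(T)$ denote its resolvent set. For $z\in\mathbb C$ let $Y(\cdot,z)=(y_{kl}(\cdot,z))_{k,l=1}^2$ be the unique absolutely continuous solution of $$-JY'(x,z)+V(x)Y(x,z)=zY(x,z)\ \text{ for a.e. } x\in[a,b],\qquad Y(a,z)=I_2,$$ and let $$c(z)=y_{12}(b,z)\cos\alpha+y_{22}(b,z)\sin\alpha ,$$ which is the denominator of the Weyl–Titchmarsh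 function $m(z)=\dfrac{y_{11}(b,z)\cos\alpha+y_{21}(b,z)\sin\alpha}{y_{12}(b,z)\cos\alpha+y_{22}(b,z)\sin\alpha}$. Then $c$ is entire, and for all $z_1,z_2\in\rho(T)$ we have $c(z_1)\neq0$, $c(z_2)\ne0$, the operator $(T-z_1)^{-1}-(T-z_2)^{-1}$ is of trace class, and $$\operatorname{tr}\big((T-z_1)^{-1}-(T-z_2)^{-1}\big)=-\frac{\dot c(z_1)}{c(z_1)}+\frac{\dot c(z_2)}{c(z_2)},$$ where $\dot c=\mathrm dc/\mathrm dz$. -/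

import Mathlib

open MeasureTheory Set Matrix

noncomputable section

namespace DiracKrein

/-! ### Unbounded operators: resolvent set and resolvent; trace class operators -/

section Operators

universe u

variable {H : Type u} [NormedAddCommGroup H] [InnerProductSpace ℂ H]

/-- `R` is a bounded, everywhere defined two-sided inverse of `T - z`. -/
structure IsResolvent (T : H →ₗ.[ℂ] H) (z : ℂ) (R : H →L[ℂ] H) : Prop where
  right_inv : ∀ g : H, ∃ h : R g ∈ T.domain, T ⟨R g, h⟩ - z • R g = g
  left_inv : ∀ f : T.domain, R (T f - z • (f : H)) = f

/-- The resolvent set `ρ(T)` of an (in general unbounded) operator `T`. -/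
def resolventSet (T : H →ₗ.[ℂ] H) : Set ℂ :=
  {z | ∃ R : H →L[ℂ] H, IsResolvent T z R}

open Classical in
/-- The resolvent `(T - z)⁻¹` for `z ∈ ρ(T)` (and `0` for other `z`). -/
def resolvent (T : H →ₗ.[ℂ] H) (z : ℂ) : H →L[ℂ] H :=
  if h : z ∈ resolventSet T then h.choose else 0

/-- The bounded operator `A` is of trace class: `∑ᵢ ⟨eᵢ, |A| eᵢ⟩ < ∞` for every orthonormal
basis `(eᵢ)`, where `|A| = (A* A)^{1/2}`. -/
def IsTraceClass [CompleteSpace H] (A : H →L[ℂ] H) : Prop :=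
  ∀ (ι : Type u) (e : HilbertBasis ι ℂ H),
    Summable fun i => (inner ℂ (e i) (CFC.abs A (e i))).re

/-- `A` is of trace class, with trace `t`: `∑ᵢ ⟨eᵢ, A eᵢ⟩ = t` for every orthonormal
basis `(eᵢ)`. -/
def HasTrace [CompleteSpace H] (A : H →L[ℂ] H) (t : ℂ) : Prop :=
  IsTraceClass A ∧
    ∀ (ι : Type u) (e : HilbertBasis ι ℂ H), HasSum (fun i => inner ℂ (e i) (A (e i))) t

end Operators

/-! ### The Dirac–Krein differential expression on an edge `[a, b]` -/

/-- The matrix `J = (0 -1; 1 0)`. -/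
def J : Matrix (Fin 2) (Fin 2) ℂ := !![0, -1; 1, 0]

/-- The potential `V(x) = (p(x) q(x); q(x) -p(x))`. -/
def V (p q : ℝ → ℝ) (x : ℝ) : Matrix (Fin 2) (Fin 2) ℂ :=
  !![(p x : ℂ), (q x : ℂ); (q x : ℂ), -(p x : ℂ)]

/-- The differential expression `(H F)(x) = -J F'(x) + V(x) F(x)`. -/
def diffExpr (p q : ℝ → ℝ) (F : ℝ → EuclideanSpace ℂ (Fin 2)) (x : ℝ) :
    EuclideanSpace ℂ (Fin 2) :=
  WithLp.toLp 2 (-(J *ᵥ (deriv F x).ofLp) + V p q x *ᵥ (F x).ofLp)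

/-- The Hilbert space of square integrable `ℂ²`-valued functions on the edge `[a, b]`. -/
abbrev L2 (a b : ℝ) : Type :=
  Lp (EuclideanSpace ℂ (Fin 2)) 2 (volume.restrict (Icc a b))

/-- `F` is an absolutely continuous representative of the class `f`, with `H F` square integrable,
and `F` satisfies the boundary conditions `F₁(a) = 0` and
`cos α F₁(b) + sin α F₂(b) = 0`. -/
structure IsDomainRep (a b : ℝ) (p q : ℝ → ℝ) (α : ℝ) (f : L2 a b)
    (F : ℝ → EuclideanSpace ℂ (Fin 2)) : Prop where
  ae_eq : f =ᵐ[volume.restrict (Icc a b)] F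
  absCont : AbsolutelyContinuousOnInterval F a b
  memLp : MemLp (diffExpr p q F) 2 (volume.restrict (Icc a b))
  bc_outer : (Real.cos α : ℂ) * F b 0 + (Real.sin α : ℂ) * F b 1 = 0
  bc_inner : F a 0 = 0

section WellDefined

variable {a b : ℝ} {p q : ℝ → ℝ} {α : ℝ}

theorem ae_differentiableAt {F : ℝ → EuclideanSpace ℂ (Fin 2)}
    (hF : AbsolutelyContinuousOnInterval F a b) :
    ∀ᵐ x ∂(volume.restrict (Icc a b)), DifferentiableAt ℝ F x := by
  have h := hF.boundedVariationOn.ae_differentiableAt_of_mem_uIcc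
  rw [ae_restrict_iff' measurableSet_Icc]
  filter_upwards [h] with x hx hx'
  exact hx (Icc_subset_uIcc hx')

theorem diffExpr_congr {F G : ℝ → EuclideanSpace ℂ (Fin 2)}
    (hF : AbsolutelyContinuousOnInterval F a b) (hG : AbsolutelyContinuousOnInterval G a b)
    (h : F =ᵐ[volume.restrict (Icc a b)] G) :
    diffExpr p q F =ᵐ[volume.restrict (Icc a b)] diffExpr p q G := by
  have hEq : EqOn F G (Ioo a b) := by
    refine Measure.eqOn_open_of_ae_eq (μ := volume) ?_ isOpen_Ioo ?_ ?_
    · exact ae_restrict_of_ae_restrict_of_subset Ioo_subset_Icc_self h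
    · exact hF.continuousOn.mono (Ioo_subset_Icc_self.trans Icc_subset_uIcc)
    · exact hG.continuousOn.mono (Ioo_subset_Icc_self.trans Icc_subset_uIcc)
  rw [← restrict_Ioo_eq_restrict_Icc]
  refine (ae_restrict_iff' measurableSet_Ioo).2 (Filter.Eventually.of_forall fun x hx => ?_)
  have h1 : F =ᶠ[nhds x] G := Filter.eventually_of_mem (isOpen_Ioo.mem_nhds hx) hEq
  simp only [diffExpr, h1.deriv_eq, hEq hx]

theorem diffExpr_add {F G : ℝ → EuclideanSpace ℂ (Fin 2)}
    (hF : AbsolutelyContinuousOnInterval F a b) (hG : AbsolutelyContinuousOnInterval G a b) :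
    diffExpr p q (F + G) =ᵐ[volume.restrict (Icc a b)] diffExpr p q F + diffExpr p q G := by
  filter_upwards [ae_differentiableAt hF, ae_differentiableAt hG] with x hFx hGx
  simp only [diffExpr, deriv_add hFx hGx, Pi.add_apply, WithLp.ofLp_add, mulVec_add,
    ← WithLp.toLp_add]
  congr 1
  abel

theorem diffExpr_smul (c : ℂ) {F : ℝ → EuclideanSpace ℂ (Fin 2)}
    (hF : AbsolutelyContinuousOnInterval F a b) :
    diffExpr p q (c • F) =ᵐ[volume.restrict (Icc a b)] c • diffExpr p q F := by
  filter_upwards [ae_differentiableAt hF] with x hFx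
  simp only [diffExpr, deriv_const_smul c hFx, Pi.smul_apply, WithLp.ofLp_smul, mulVec_smul,
    ← WithLp.toLp_smul, smul_add, smul_neg]

theorem IsDomainRep.add {f g : L2 a b} {F G : ℝ → EuclideanSpace ℂ (Fin 2)}
    (hF : IsDomainRep a b p q α f F) (hG : IsDomainRep a b p q α g G) :
    IsDomainRep a b p q α (f + g) (F + G) where
  ae_eq := (Lp.coeFn_add f g).trans (hF.ae_eq.add hG.ae_eq)
  absCont := hF.absCont.add hG.absCont
  memLp := (hF.memLp.add hG.memLp).ae_eq (diffExpr_add hF.absCont hG.absCont).symm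
  bc_outer := by
    have h1 := hF.bc_outer
    have h2 := hG.bc_outer
    simp only [Pi.add_apply, PiLp.add_apply]
    linear_combination h1 + h2
  bc_inner := by simp [hF.bc_inner, hG.bc_inner]

theorem IsDomainRep.smul (c : ℂ) {f : L2 a b} {F : ℝ → EuclideanSpace ℂ (Fin 2)}
    (hF : IsDomainRep a b p q α f F) : IsDomainRep a b p q α (c • f) (c • F) where
  ae_eq := (Lp.coeFn_smul c f).trans (hF.ae_eq.const_smul c)
  absCont := hF.absCont.const_smul c
  memLp := (hF.memLp.const_smul c).ae_eq (diffExpr_smul c hF.absCont).symm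
  bc_outer := by
    have h1 := hF.bc_outer
    simp only [Pi.smul_apply, PiLp.smul_apply, smul_eq_mul]
    linear_combination c * h1
  bc_inner := by simp [hF.bc_inner]

theorem isDomainRep_zero : IsDomainRep a b p q α (0 : L2 a b) 0 where
  ae_eq := Lp.coeFn_zero _ _ _
  absCont := by
    have := (LipschitzWith.const (0 : EuclideanSpace ℂ (Fin 2))).lipschitzOnWith
      (s := uIcc a b)
    exact this.absolutelyContinuousOnInterval
  memLp := by
    have : diffExpr p q 0 = 0 := by
      funext x
      simp [diffExpr]
    rw [this]
    exact MemLp.zero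
  bc_outer := by simp
  bc_inner := by simp

theorem IsDomainRep.toLp_eq {f : L2 a b} {F G : ℝ → EuclideanSpace ℂ (Fin 2)}
    (hF : IsDomainRep a b p q α f F) (hG : IsDomainRep a b p q α f G) :
    hF.memLp.toLp = hG.memLp.toLp :=
  (MemLp.toLp_eq_toLp_iff _ _).2
    (diffExpr_congr hF.absCont hG.absCont (hF.ae_eq.symm.trans hG.ae_eq))

end WellDefined

/-- The domain of the operator `T` on the edge `[a, b]`. -/
def domT (a b : ℝ) (p q : ℝ → ℝ) (α : ℝ) : Submodule ℂ (L2 a b) where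
  carrier := {f | ∃ F, IsDomainRep a b p q α f F}
  add_mem' := fun ⟨F, hF⟩ ⟨G, hG⟩ => ⟨F + G, hF.add hG⟩
  zero_mem' := ⟨0, isDomainRep_zero⟩
  smul_mem' := fun c _ ⟨F, hF⟩ => ⟨c • F, hF.smul c⟩

/-- The Dirac–Krein operator `T` on the edge `[a, b]`: `T f = H f = -J f' + V f`, with boundary
conditions `f₁(a) = 0` and `cos α f₁(b) + sin α f₂(b) = 0`. (The absolutely continuous
representative of `f` is unique on `[a, b]`.) -/
def T (a b : ℝ) (p q : ℝ → ℝ) (α : ℝ) : L2 a b →ₗ.[ℂ] L2 a b where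
  domain := domT a b p q α
  toFun :=
    { toFun := fun f => f.2.choose_spec.memLp.toLp
      map_add' := fun f g => by
        rw [IsDomainRep.toLp_eq (f + g).2.choose_spec
          (f.2.choose_spec.add g.2.choose_spec), ← MemLp.toLp_add]
        exact (MemLp.toLp_eq_toLp_iff _ _).2
          (diffExpr_add f.2.choose_spec.absCont g.2.choose_spec.absCont)
      map_smul' := fun c f => by
        rw [IsDomainRep.toLp_eq (c • f).2.choose_spec (f.2.choose_spec.smul c),
          RingHom.id_apply, ← MemLp.toLp_const_smul]
        exact (MemLp.toLp_eq_toLp_iff _ _).2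
          (diffExpr_smul c f.2.choose_spec.absCont) }

/-- The action of `T` may be computed with any absolutely continuous representative. -/
theorem T_apply {a b : ℝ} {p q : ℝ → ℝ} {α : ℝ} (f : (T a b p q α).domain)
    {F : ℝ → EuclideanSpace ℂ (Fin 2)} (hF : IsDomainRep a b p q α f F) :
    T a b p q α f = hF.memLp.toLp :=
  IsDomainRep.toLp_eq f.2.choose_spec hF

/-! ### The fundamental matrix and the denominator of the Weyl–Titchmarsh function -/

/-- `Y` is the fundamental matrix for the spectral parameter `z`: its columns are absolutely
continuous on `[a, b]` and satisfy `-J Y' + V Y = z Y` almost everywhere on `[a, b]`, and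
`Y(a) = I`. -/
structure IsFundamentalMatrix (a b : ℝ) (p q : ℝ → ℝ) (z : ℂ)
    (Y : ℝ → Matrix (Fin 2) (Fin 2) ℂ) : Prop where
  absCont : ∀ k, AbsolutelyContinuousOnInterval (fun x => WithLp.toLp 2 ((Y x).col k)) a b
  ode : ∀ k, ∀ᵐ x ∂(volume.restrict (Icc a b)),
    diffExpr p q (fun t => WithLp.toLp 2 ((Y t).col k)) x = z • WithLp.toLp 2 ((Y x).col k)
  init : Y a = 1

open Classical in
/-- The fundamental matrix `Y(·, z)`. It exists for integrable `p`, `q`, and it is uniquely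
determined on `[a, b]`. (The default value `0` is only used if there is none.) -/
def fundamentalMatrix (a b : ℝ) (p q : ℝ → ℝ) (z : ℂ) : ℝ → Matrix (Fin 2) (Fin 2) ℂ :=
  if h : ∃ Y, IsFundamentalMatrix a b p q z Y then h.choose else 0

/-- The function `c(z) = y₁₂(b, z) cos α + y₂₂(b, z) sin α`, the denominator of the
Weyl–Titchmarsh function
`m(z) = (y₁₁(b, z) cos α + y₂₁(b, z) sin α) / (y₁₂(b, z) cos α + y₂₂(b, z) sin α)`. -/
def c (a b : ℝ) (p q : ℝ → ℝ) (α : ℝ) (z : ℂ) : ℂ :=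
  fundamentalMatrix a b p q z b 0 1 * (Real.cos α : ℂ) +
    fundamentalMatrix a b p q z b 1 1 * (Real.sin α : ℂ)

end DiracKrein

end

/-! Write `φ_z` for the second column of the fundamental matrix, which satisfies the condition at
`a`, and `ψ_z` for the solution `rightSol` with value `(sin α, -cos α)` at `b`, which satisfies the
condition at `b`. Their Wronskian is constant in `x` and equals `c z`. If `c z = 0`, then `φ_z` is
an eigenfunction, so `c` has no zero on the resolvent set; elsewhere the resolvent is the integral
operator with Green kernel `-ψ_z(x) φ_z(y)ᵗ / c z` for `y ≤ x` and `-φ_z(x) ψ_z(y)ᵗ / c z` for `y >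
x` (`IsResolvent.apply_eq_integral`).

This kernel is bounded on a finite measure space, so each resolvent is Hilbert–Schmidt. The
resolvent identity makes the difference of resolvents `(z₁ - z₂)` times a product of two such
operators; it is therefore of trace class, and its trace is the integral over `x` of the paired rows
of the kernels (`HasRowKernel.hasTrace`).

Lagrange's identity evaluates everything else. Applied on `[a, x]` and on `[x, b]`, it turns `z₁ -
z₂` times the inner integrals into Wronskians at `x`, and an algebraic identity for four vectors
reduces these to `φ·ψ / c` at `z₂` minus the same at `z₁` (`sub_mul_sum_integral_greenRow`). Applied
to `φ_z` and `ψ_w` on `[a, b]`, it gives `c z - c w = (z - w) ∫ φ_z·ψ_w`, so that `c` is entire with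
derivative `∫ φ_w·ψ_w` (`hasDerivAt_c`). The limit `z → w` needs only continuity of `φ_z` in `z`,
which follows by inverting a Volterra operator affine in `z`. -/

noncomputable section

/-! ### Absolutely continuous functions with values in a normed space -/

section AbsolutelyContinuous

open AbsolutelyContinuousOnInterval Filter Topology

theorem AbsolutelyContinuousOnInterval.of_dist_le {X Y : Type*} [PseudoMetricSpace X]
    [PseudoMetricSpace Y] {f : ℝ → X} {g : ℝ → Y} {a b : ℝ}
    (hg : AbsolutelyContinuousOnInterval g a b)
    (h : ∀ x ∈ uIcc a b, ∀ y ∈ uIcc a b, dist (f x) (f y) ≤ dist (g x) (g y)) :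
    AbsolutelyContinuousOnInterval f a b := by
  rw [absolutelyContinuousOnInterval_iff] at hg ⊢
  intro ε hε
  obtain ⟨δ, hδ, H⟩ := hg ε hε
  refine ⟨δ, hδ, fun E hE hlt => lt_of_le_of_lt (Finset.sum_le_sum fun i hi => ?_) (H E hE hlt)⟩
  exact h _ (hE.1 i hi).1 _ (hE.1 i hi).2

theorem AbsolutelyContinuousOnInterval.clm_comp {𝕜 E F : Type*} [NontriviallyNormedField 𝕜]
    [NormedAddCommGroup E]
    [NormedSpace 𝕜 E] [NormedAddCommGroup F] [NormedSpace 𝕜 F] [NormedSpace ℝ E] (L : E →L[𝕜] F)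
    {f : ℝ → E} {a b : ℝ} (hf : AbsolutelyContinuousOnInterval f a b) :
    AbsolutelyContinuousOnInterval (fun x => L (f x)) a b := by
  refine (hf.const_smul ‖L‖).of_dist_le fun x _ y _ => ?_
  rw [dist_smul₀, norm_norm, dist_eq_norm, dist_eq_norm, ← map_sub]
  exact L.le_opNorm _

theorem IntervalIntegrable.absolutelyContinuousOnInterval_integral {E : Type*}
    [NormedAddCommGroup E] [NormedSpace ℝ E] {f : ℝ → E} {a b : ℝ}
    (h : IntervalIntegrable f volume a b) :
    AbsolutelyContinuousOnInterval (fun x => ∫ t in a..x, f t) a b := by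
  refine (h.norm.absolutelyContinuousOnInterval_intervalIntegral left_mem_uIcc).of_dist_le
    fun x hx y hy => ?_
  have hx' := h.mono_set (uIcc_subset_uIcc left_mem_uIcc hx)
  have hy' := h.mono_set (uIcc_subset_uIcc left_mem_uIcc hy)
  rw [dist_eq_norm, dist_eq_norm, intervalIntegral.integral_interval_sub_left hx' hy',
    intervalIntegral.integral_interval_sub_left hx'.norm hy'.norm]
  exact intervalIntegral.norm_integral_le_abs_integral_norm

/-- The difference of `F` and the primitive of `f` is absolutely continuous with derivative zero
almost everywhere, hence constant. -/
theorem AbsolutelyContinuousOnInterval.eq_add_integral {E : Type*}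
    [NormedAddCommGroup E] [NormedSpace ℝ E] [CompleteSpace E] {F f : ℝ → E} {a b : ℝ} (hab : a ≤ b)
    (hF : AbsolutelyContinuousOnInterval F a b) (h : IntervalIntegrable f volume a b)
    (hd : ∀ᵐ x ∂(volume.restrict (Icc a b)), HasDerivAt F (f x) x) {x : ℝ} (hx : x ∈ Icc a b) :
    F x = F a + ∫ t in a..x, f t := by
  have hac := hF.sub h.absolutelyContinuousOnInterval_integral
  have h0 : ∀ᵐ x, x ∈ uIcc a b →
      HasDerivAt (F - fun x => ∫ t in a..x, f t) 0 x := by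
    rw [ae_restrict_iff' measurableSet_Icc] at hd
    filter_upwards [hd, h.ae_hasDerivAt_integral] with x h1 h2 hx
    have := (h1 (by rwa [uIcc_of_le hab] at hx)).sub (h2 hx a left_mem_uIcc)
    simpa using this
  obtain ⟨C, hC⟩ := hac.const_of_ae_hasDerivAt_zero h0
  have h1 := hC a left_mem_uIcc
  have h2 := hC x (by rwa [uIcc_of_le hab])
  simp only [Pi.sub_apply, intervalIntegral.integral_same, sub_zero] at h1 h2
  rw [h1, ← h2]; abel

theorem AbsolutelyContinuousOnInterval.sub_eq_integral {E : Type*}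
    [NormedAddCommGroup E] [NormedSpace ℝ E] [CompleteSpace E] {F f : ℝ → E} {a b : ℝ} (hab : a ≤ b)
    (hF : AbsolutelyContinuousOnInterval F a b) (h : IntervalIntegrable f volume a b)
    (hd : ∀ᵐ x ∂(volume.restrict (Icc a b)), HasDerivAt F (f x) x) {x y : ℝ} (hx : x ∈ Icc a b)
    (hy : y ∈ Icc a b) :
    F y - F x = ∫ t in x..y, f t := by
  rw [← uIcc_of_le hab] at hx hy
  rw [hF.eq_add_integral hab h hd (x := x) (uIcc_of_le hab ▸ hx),
    hF.eq_add_integral hab h hd (x := y) (uIcc_of_le hab ▸ hy), add_sub_add_left_eq_sub,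
    intervalIntegral.integral_interval_sub_left
      (h.mono_set (uIcc_subset_uIcc left_mem_uIcc hy))
      (h.mono_set (uIcc_subset_uIcc left_mem_uIcc hx))]

end AbsolutelyContinuous

/-! ### Volterra integral operators with integrable coefficients -/

section Volterra

open Filter Topology

variable {E : Type*} [NormedAddCommGroup E] [NormedSpace ℂ E]

theorem IntervalIntegrable.clm_apply_continuous {M : ℝ → E →L[ℂ] E} {a b : ℝ}
    (hM : IntervalIntegrable M volume a b) {u : ℝ → E} (hu : Continuous u) :
    IntervalIntegrable (fun t => M t (u t)) volume a b := by
  obtain ⟨C, hC⟩ := isCompact_uIcc.exists_bound_of_continuousOn (s := uIcc a b) hu.continuousOn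
  rw [intervalIntegrable_iff] at hM ⊢
  refine Integrable.mono' (hM.norm.mul_const C) ?_ ?_
  · exact (ContinuousLinearMap.id ℂ (E →L[ℂ] E)).aestronglyMeasurable_comp₂
      hM.aestronglyMeasurable hu.aestronglyMeasurable
  · refine (ae_restrict_iff' measurableSet_uIoc).2 (Eventually.of_forall fun t ht => ?_)
    exact ((M t).le_opNorm _).trans
      (mul_le_mul_of_nonneg_left (hC t (uIoc_subset_uIcc ht)) (norm_nonneg _))

variable {a b : ℝ} (hab : a ≤ b) {M : ℝ → E →L[ℂ] E}

/-- Composition with `projIcc` extends `u` continuously to the line, so that interval integrals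
apply; values outside `[a, b]` never matter. -/
theorem intervalIntegrable_clm_apply_projIcc (hM : IntervalIntegrable M volume a b)
    (u : C(Icc a b, E)) :
    IntervalIntegrable (fun t => M t (u (projIcc a b hab t))) volume a b :=
  hM.clm_apply_continuous (u.continuous.comp continuous_projIcc)

theorem norm_integral_clm_apply_projIcc_le (hM : IntervalIntegrable M volume a b)
    (u : C(Icc a b, E)) {g : ℝ → ℝ} (hg : ContinuousOn g (Icc a b))
    (hu : ∀ x, ‖u x‖ ≤ g x) (x : Icc a b) :
    ‖∫ t in a..x, M t (u (projIcc a b hab t))‖ ≤ ∫ t in a..x, g t * ‖M t‖ := by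
  have hsub : uIcc a (x : ℝ) ⊆ uIcc a b :=
    uIcc_subset_uIcc left_mem_uIcc (by rw [uIcc_of_le hab]; exact x.2)
  refine intervalIntegral.norm_integral_le_of_norm_le x.2.1 ?_ ?_
  · refine Eventually.of_forall fun t ht => ?_
    have htm : t ∈ Icc a b := ⟨ht.1.le, ht.2.trans x.2.2⟩
    rw [projIcc_of_mem hab htm, mul_comm]
    exact ((M t).le_opNorm _).trans (mul_le_mul_of_nonneg_left (hu ⟨t, htm⟩) (norm_nonneg _))
  · refine (hM.mono_set hsub).norm.continuousOn_mul (hg.mono ?_)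
    rwa [uIcc_of_le hab] at hsub

/-- The Volterra operator `u ↦ ∫ₐˣ M(t) u(t) dt` on continuous functions. -/
def volterra (hM : IntervalIntegrable M volume a b) : C(Icc a b, E) →L[ℂ] C(Icc a b, E) :=
  LinearMap.mkContinuous
    { toFun := fun u =>
        ⟨fun x => ∫ t in a..x, M t (u (projIcc a b hab t)), by
          have := (intervalIntegral.continuousOn_primitive_interval'
            (intervalIntegrable_clm_apply_projIcc hab hM u) left_mem_uIcc)
          rw [uIcc_of_le hab] at this
          exact this.domRestrict⟩
      map_add' := fun u v => by
        ext x
        have hsub : uIcc a (x : ℝ) ⊆ uIcc a b :=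
          uIcc_subset_uIcc left_mem_uIcc (by rw [uIcc_of_le hab]; exact x.2)
        simp only [ContinuousMap.coe_mk, ContinuousMap.add_apply, map_add]
        exact intervalIntegral.integral_add
          ((intervalIntegrable_clm_apply_projIcc hab hM u).mono_set hsub)
          ((intervalIntegrable_clm_apply_projIcc hab hM v).mono_set hsub)
      map_smul' := fun c u => by
        ext x
        simp only [ContinuousMap.coe_mk, ContinuousMap.smul_apply, map_smul, RingHom.id_apply]
        exact intervalIntegral.integral_smul _ _ }
    (∫ t in a..b, ‖M t‖) fun u => by
      refine (ContinuousMap.norm_le _ (mul_nonneg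
        (intervalIntegral.integral_nonneg hab fun _ _ => norm_nonneg _) (norm_nonneg _))).2
        fun x => ?_
      refine (norm_integral_clm_apply_projIcc_le hab hM u (g := fun _ => ‖u‖) continuousOn_const
        (fun x => u.norm_coe_le_norm x) x).trans ?_
      rw [intervalIntegral.integral_const_mul, mul_comm]
      refine mul_le_mul_of_nonneg_right ?_ (norm_nonneg _)
      exact intervalIntegral.integral_mono_interval le_rfl x.2.1 x.2.2
        (Eventually.of_forall fun _ => norm_nonneg _) hM.norm

@[simp]
theorem volterra_apply (hM : IntervalIntegrable M volume a b) (u : C(Icc a b, E)) (x : Icc a b) :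
    volterra hab hM u x = ∫ t in a..x, M t (u (projIcc a b hab t)) := rfl

theorem AbsolutelyContinuousOnInterval.fun_pow_succ {f : ℝ → ℝ} {a b : ℝ}
    (hf : AbsolutelyContinuousOnInterval f a b) (n : ℕ) :
    AbsolutelyContinuousOnInterval (fun x => f x ^ (n + 1)) a b := by
  induction n with
  | zero => simpa using hf
  | succ n ih => simpa only [pow_succ _ (n + 1)] using ih.fun_mul hf

include hab in
-- As `f` is merely integrable, the power rule for its primitive holds only almost everywhere;
-- absolute continuity of the powers still allows integration. This is the induction step of the
-- factorial bound below.
theorem integral_primitive_pow_mul {f : ℝ → ℝ} (hf : IntervalIntegrable f volume a b) (n : ℕ)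
    {x : ℝ} (hx : x ∈ Icc a b) :
    ∫ t in a..x, (∫ s in a..t, f s) ^ n / n.factorial * f t =
      (∫ s in a..x, f s) ^ (n + 1) / (n + 1).factorial := by
  have hac := hf.absolutelyContinuousOnInterval_integral
  have h1 := ((hac.fun_pow_succ n).const_mul ((n + 1).factorial : ℝ)⁻¹).eq_add_integral
    (f := fun t => (∫ s in a..t, f s) ^ n / n.factorial * f t) hab
    (hf.continuousOn_mul ((hac.continuousOn.pow n).div_const _)) ?_ hx
  · simp only [intervalIntegral.integral_same, ne_eq, Nat.add_eq_zero_iff, one_ne_zero, and_false,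
      not_false_eq_true, zero_pow, mul_zero, zero_add] at h1
    rw [← h1, div_eq_inv_mul]
  · rw [ae_restrict_iff' measurableSet_Icc]
    filter_upwards [hf.ae_hasDerivAt_integral] with x h2 hx
    have h3 := ((h2 (by rwa [uIcc_of_le hab]) a left_mem_uIcc).pow (n + 1)).const_mul
      ((n + 1).factorial : ℝ)⁻¹
    convert! h3 using 1
    rw [Nat.factorial_succ]
    have : (n.factorial : ℝ) ≠ 0 := by positivity
    have : ((n + 1 : ℕ) : ℝ) ≠ 0 := by positivity
    push_cast
    push_cast at this
    field_simp

theorem norm_volterra_pow_apply_le (hM : IntervalIntegrable M volume a b) (n : ℕ)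
    (u : C(Icc a b, E)) (x : Icc a b) :
    ‖(volterra hab hM ^ n) u x‖ ≤ (∫ t in a..x, ‖M t‖) ^ n / n.factorial * ‖u‖ := by
  induction n generalizing x with
  | zero => simpa using u.norm_coe_le_norm x
  | succ n ih =>
    rw [pow_succ', mul_apply_eq_comp, volterra_apply]
    have hc : ContinuousOn (fun x => ∫ t in a..x, ‖M t‖) (Icc a b) := by
      have := intervalIntegral.continuousOn_primitive_interval' hM.norm left_mem_uIcc
      rwa [uIcc_of_le hab] at this
    refine (norm_integral_clm_apply_projIcc_le hab hM _
      (((hc.pow n).div_const _).mul continuousOn_const) ih x).trans_eq ?_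
    rw [← integral_primitive_pow_mul hab hM.norm n x.2, ← intervalIntegral.integral_mul_const]
    refine intervalIntegral.integral_congr fun t _ => ?_
    simp only [Pi.mul_apply, Pi.pow_apply]
    ring

theorem norm_volterra_pow_le (hM : IntervalIntegrable M volume a b) (n : ℕ) :
    ‖volterra hab hM ^ n‖ ≤ (∫ t in a..b, ‖M t‖) ^ n / n.factorial := by
  have h0 : ∀ x ∈ Icc a b, 0 ≤ ∫ t in a..x, ‖M t‖ := fun x hx =>
    intervalIntegral.integral_nonneg hx.1 fun _ _ => norm_nonneg _
  have hb := h0 b (right_mem_Icc.2 hab)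
  refine ContinuousLinearMap.opNorm_le_bound _ (by positivity) fun u => ?_
  refine (ContinuousMap.norm_le _ (by positivity)).2 fun x => ?_
  refine (norm_volterra_pow_apply_le hab hM n u x).trans ?_
  have hx := h0 x x.2
  gcongr
  exact intervalIntegral.integral_mono_interval le_rfl x.2.1 x.2.2
        (Eventually.of_forall fun _ => norm_nonneg _) hM.norm

/-- By the factorial bound some power `Vⁿ` has norm below `1`, so `1 - Vⁿ` is a unit; `1 - V` is one
of its two commuting factors, the other being the geometric sum. -/
theorem isUnit_one_sub_volterra [CompleteSpace E] (hM : IntervalIntegrable M volume a b) :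
    IsUnit (1 - volterra hab hM) := by
  obtain ⟨n, hn⟩ := ((FloorSemiring.tendsto_pow_div_factorial_atTop
    (∫ t in a..b, ‖M t‖)).eventually (gt_mem_nhds zero_lt_one)).exists
  have h1 : IsUnit (1 - volterra hab hM ^ n) :=
    isUnit_one_sub_of_norm_lt_one (R := C(Icc a b, E) →L[ℂ] C(Icc a b, E))
      ((norm_volterra_pow_le hab hM n).trans_lt hn)
  have hc : Commute (1 - volterra hab hM) (∑ i ∈ Finset.range n, volterra hab hM ^ i) :=
    Commute.sum_right _ _ _ fun i _ =>
      ((Commute.one_left _).sub_left (Commute.refl _)).pow_right i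
  rw [← mul_neg_geom_sum] at h1
  exact (hc.isUnit_mul_iff.1 h1).1

theorem volterra_smul_add {N : ℝ → E →L[ℂ] E} (hM : IntervalIntegrable M volume a b)
    (hN : IntervalIntegrable N volume a b) (z : ℂ)
    (h : IntervalIntegrable (fun t => z • M t + N t) volume a b) :
    volterra hab h = z • volterra hab hM + volterra hab hN := by
  ext u x
  have hsub : uIcc a (x : ℝ) ⊆ uIcc a b :=
    uIcc_subset_uIcc left_mem_uIcc (by rw [uIcc_of_le hab]; exact x.2)
  simp only [_root_.add_apply, _root_.smul_apply,
    ContinuousMap.add_apply, ContinuousMap.smul_apply, volterra_apply]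
  rw [← intervalIntegral.integral_smul, ← intervalIntegral.integral_add]
  · exact ((intervalIntegrable_clm_apply_projIcc hab hM u).mono_set hsub).smul z
  · exact (intervalIntegrable_clm_apply_projIcc hab hN u).mono_set hsub

end Volterra

namespace DiracKrein

/-! ### Lagrange's identity -/

section Lagrange

open Filter Topology

/-- The bilinear pairing `uᵗ v` on `ℂ²`. -/
def dot (u v : EuclideanSpace ℂ (Fin 2)) : ℂ := u 0 * v 0 + u 1 * v 1

/-- The Wronskian `uᵗ J v` on `ℂ²`. -/
def wronskian (u v : EuclideanSpace ℂ (Fin 2)) : ℂ := u 1 * v 0 - u 0 * v 1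

variable {a b : ℝ} {p q : ℝ → ℝ}

theorem diffExpr_apply_zero (F : ℝ → EuclideanSpace ℂ (Fin 2)) (x : ℝ) :
    diffExpr p q F x 0 = deriv F x 1 + p x * F x 0 + q x * F x 1 := by
  simp [diffExpr, J, V, dotProduct, Fin.sum_univ_two]
  ring

theorem diffExpr_apply_one (F : ℝ → EuclideanSpace ℂ (Fin 2)) (x : ℝ) :
    diffExpr p q F x 1 = -deriv F x 0 + q x * F x 0 - p x * F x 1 := by
  simp [diffExpr, J, V, dotProduct, Fin.sum_univ_two]
  ring

theorem hasDerivAt_apply {F : ℝ → EuclideanSpace ℂ (Fin 2)} {F' : EuclideanSpace ℂ (Fin 2)}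
    {x : ℝ} (h : HasDerivAt F F' x) (k : Fin 2) : HasDerivAt (fun t => F t k) (F' k) x :=
  ((EuclideanSpace.proj k : EuclideanSpace ℂ (Fin 2) →L[ℂ] ℂ).restrictScalars
    ℝ).hasFDerivAt.comp_hasDerivAt x h

theorem absolutelyContinuousOnInterval_apply {F : ℝ → EuclideanSpace ℂ (Fin 2)}
    (h : AbsolutelyContinuousOnInterval F a b) (k : Fin 2) :
    AbsolutelyContinuousOnInterval (fun t => F t k) a b :=
  h.clm_comp (EuclideanSpace.proj k : EuclideanSpace ℂ (Fin 2) →L[ℂ] ℂ)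

theorem absolutelyContinuousOnInterval_wronskian {u F : ℝ → EuclideanSpace ℂ (Fin 2)}
    (hu : AbsolutelyContinuousOnInterval u a b) (hF : AbsolutelyContinuousOnInterval F a b) :
    AbsolutelyContinuousOnInterval (fun x => wronskian (u x) (F x)) a b :=
  ((absolutelyContinuousOnInterval_apply hu 1).fun_smul
    (absolutelyContinuousOnInterval_apply hF 0)).fun_sub
    ((absolutelyContinuousOnInterval_apply hu 0).fun_smul
      (absolutelyContinuousOnInterval_apply hF 1))

theorem continuousOn_apply {u : ℝ → EuclideanSpace ℂ (Fin 2)} {s : Set ℝ} (hu : ContinuousOn u s)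
    (k : Fin 2) : ContinuousOn (fun x => u x k) s :=
  (EuclideanSpace.proj k : EuclideanSpace ℂ (Fin 2) →L[ℂ] ℂ).continuous.comp_continuousOn hu

theorem integrableOn_apply {u : ℝ → EuclideanSpace ℂ (Fin 2)} {s : Set ℝ} (hu : IntegrableOn u s)
    (k : Fin 2) : IntegrableOn (fun x => u x k) s :=
  (EuclideanSpace.proj k : EuclideanSpace ℂ (Fin 2) →L[ℂ] ℂ).integrable_comp hu

theorem integrableOn_dot {u f : ℝ → EuclideanSpace ℂ (Fin 2)} (hu : ContinuousOn u (Icc a b))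
    (hf : IntegrableOn f (Icc a b)) : IntegrableOn (fun x => dot (u x) (f x)) (Icc a b) :=
  ((integrableOn_apply hf 0).continuousOn_mul (continuousOn_apply hu 0) isCompact_Icc).add
    ((integrableOn_apply hf 1).continuousOn_mul (continuousOn_apply hu 1) isCompact_Icc)

theorem dot_comm (u v : EuclideanSpace ℂ (Fin 2)) : dot u v = dot v u := by
  simp only [dot]; ring

/-- The derivative of the Wronskian is `dot (Hu) F - dot u (HF)`, because the symmetric matrix `V`
cancels. The pairing is bilinear, so no conjugates of `z` and `w` appear. The inhomogeneous terms
are needed for functions in the range of the resolvent. -/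
theorem lagrange (hab : a ≤ b) {u F f g : ℝ → EuclideanSpace ℂ (Fin 2)} {z w : ℂ}
    (hu : AbsolutelyContinuousOnInterval u a b) (hF : AbsolutelyContinuousOnInterval F a b)
    (hf : IntegrableOn f (Icc a b)) (hg : IntegrableOn g (Icc a b))
    (hdu : ∀ᵐ x ∂(volume.restrict (Icc a b)), diffExpr p q u x = z • u x + f x)
    (hdF : ∀ᵐ x ∂(volume.restrict (Icc a b)), diffExpr p q F x = w • F x + g x)
    {x y : ℝ} (hx : x ∈ Icc a b) (hy : y ∈ Icc a b) :
    wronskian (u y) (F y) - wronskian (u x) (F x) =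
      ∫ t in x..y, (z - w) * dot (u t) (F t) + dot (f t) (F t) - dot (u t) (g t) := by
  have huc := hu.continuousOn
  have hFc := hF.continuousOn
  rw [uIcc_of_le hab] at huc hFc
  refine (absolutelyContinuousOnInterval_wronskian hu hF).sub_eq_integral hab ?_ ?_ hx hy
  · rw [intervalIntegrable_iff_integrableOn_Icc_of_le hab]
    refine (IntegrableOn.add ?_ ?_).sub (integrableOn_dot huc hg)
    · exact (integrableOn_dot huc (hFc.integrableOn_compact isCompact_Icc)).const_mul _
    · simp only [dot_comm (f _)]
      exact integrableOn_dot hFc hf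
  · filter_upwards [ae_differentiableAt hu, ae_differentiableAt hF, hdu, hdF] with t h1 h2 h3 h4
    have h1 := h1.hasDerivAt
    have h2 := h2.hasDerivAt
    have := ((hasDerivAt_apply h1 1).mul (hasDerivAt_apply h2 0)).sub
      ((hasDerivAt_apply h1 0).mul (hasDerivAt_apply h2 1))
    refine this.congr_deriv ?_
    have e1 := congrArg (· 0) h3
    have e2 := congrArg (· 1) h3
    have e3 := congrArg (· 0) h4
    have e4 := congrArg (· 1) h4
    simp only [diffExpr_apply_zero, diffExpr_apply_one, PiLp.add_apply, PiLp.smul_apply,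
      smul_eq_mul] at e1 e2 e3 e4
    simp only [dot]
    linear_combination F t 0 * e1 + F t 1 * e2 - u t 0 * e3 - u t 1 * e4

end Lagrange

/-! ### The fundamental matrix -/

section Fundamental

open Filter Topology

variable {a b : ℝ} {p q : ℝ → ℝ}

/-- The operator on `ℂ²` with matrix `A`. -/
abbrev matrixCLM (A : Matrix (Fin 2) (Fin 2) ℂ) :
    EuclideanSpace ℂ (Fin 2) →L[ℂ] EuclideanSpace ℂ (Fin 2) :=
  Matrix.toEuclideanCLM (n := Fin 2) (𝕜 := ℂ) A

/-- The part `-J V(x)` of the coefficient of the Dirac–Krein system in the form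
`F' = (z J - J V) F`. -/
def potentialCoeff (p q : ℝ → ℝ) (x : ℝ) :
    EuclideanSpace ℂ (Fin 2) →L[ℂ] EuclideanSpace ℂ (Fin 2) :=
  (p x : ℂ) • matrixCLM !![0, -1; -1, 0] + (q x : ℂ) • matrixCLM !![1, 0; 0, -1]

/-- The coefficient of the Dirac–Krein system in the form `F' = (z J - J V) F`. -/
def coeff (p q : ℝ → ℝ) (z : ℂ) (x : ℝ) :
    EuclideanSpace ℂ (Fin 2) →L[ℂ] EuclideanSpace ℂ (Fin 2) :=
  z • matrixCLM J + potentialCoeff p q x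

theorem diffExpr_eq_smul_iff {F : ℝ → EuclideanSpace ℂ (Fin 2)} {x : ℝ} {z : ℂ} :
    diffExpr p q F x = z • F x ↔ deriv F x = coeff p q z x (F x) := by
  have h (u v : EuclideanSpace ℂ (Fin 2)) : u = v ↔ u 0 = v 0 ∧ u 1 = v 1 := by
    rw [PiLp.ext_iff, Fin.forall_fin_two]
  rw [h, h, diffExpr_apply_zero, diffExpr_apply_one]
  simp [coeff, potentialCoeff, J, Matrix.mulVec, dotProduct, Fin.sum_univ_two]
  constructor
  · rintro ⟨h1, h2⟩
    exact ⟨by linear_combination -h2, by linear_combination h1⟩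
  · rintro ⟨h1, h2⟩
    exact ⟨by linear_combination h2, by linear_combination -h1⟩

theorem intervalIntegrable_potentialCoeff (hab : a ≤ b) (hp : IntegrableOn p (Icc a b))
    (hq : IntegrableOn q (Icc a b)) : IntervalIntegrable (potentialCoeff p q) volume a b := by
  have h (E : Type) [NormedAddCommGroup E] [NormedSpace ℂ E] (c : E) {f : ℝ → ℝ}
      (hf : IntegrableOn f (Icc a b)) :
      IntervalIntegrable (fun x => (f x : ℂ) • c) volume a b := by
    rw [intervalIntegrable_iff_integrableOn_Icc_of_le hab]
    exact Integrable.smul_const (Integrable.ofReal hf) c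
  exact (h _ _ hp).add (h _ _ hq)

theorem intervalIntegrable_coeff (hab : a ≤ b) (hp : IntegrableOn p (Icc a b))
    (hq : IntegrableOn q (Icc a b)) (z : ℂ) : IntervalIntegrable (coeff p q z) volume a b :=
  intervalIntegrable_const.add (intervalIntegrable_potentialCoeff hab hp hq)

/-- The solution of the Dirac–Krein system on `[a, b]` with initial value `v` at `a`. -/
def initialValueSol (hab : a ≤ b) (hp : IntegrableOn p (Icc a b)) (hq : IntegrableOn q (Icc a b))
    (v : EuclideanSpace ℂ (Fin 2)) (z : ℂ) : C(Icc a b, EuclideanSpace ℂ (Fin 2)) :=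
  Ring.inverse (1 - volterra hab (intervalIntegrable_coeff hab hp hq z)) (ContinuousMap.const _ v)

/-- The Volterra operator is affine in `z`, and inversion is continuous at units. The target carries
the sup norm, so the continuity is uniform in `x`. -/
theorem continuous_initialValueSol (hab : a ≤ b) (hp : IntegrableOn p (Icc a b))
    (hq : IntegrableOn q (Icc a b)) (v : EuclideanSpace ℂ (Fin 2)) :
    Continuous (initialValueSol hab hp hq v) := by
  refine Continuous.clm_apply ?_ continuous_const
  rw [continuous_iff_continuousAt]
  intro z
  have h1 : ∀ z, volterra hab (intervalIntegrable_coeff hab hp hq z) =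
      z • volterra hab (intervalIntegrable_const (c := matrixCLM J)) +
        volterra hab (intervalIntegrable_potentialCoeff hab hp hq) := fun z =>
    volterra_smul_add hab _ _ z _
  have h2 : Continuous fun z => 1 - volterra hab (intervalIntegrable_coeff hab hp hq z) := by
    simp only [h1]
    fun_prop
  obtain ⟨w, hw⟩ := isUnit_one_sub_volterra hab (intervalIntegrable_coeff hab hp hq z)
  have h3 := NormedRing.inverse_continuousAt
    (R := C(Icc a b, EuclideanSpace ℂ (Fin 2)) →L[ℂ] C(Icc a b, EuclideanSpace ℂ (Fin 2))) w
  rw [hw] at h3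
  exact h3.comp (f := fun z => 1 - volterra hab (intervalIntegrable_coeff hab hp hq z))
    h2.continuousAt

theorem initialValueSol_apply (hab : a ≤ b) (hp : IntegrableOn p (Icc a b))
    (hq : IntegrableOn q (Icc a b)) (v : EuclideanSpace ℂ (Fin 2)) (z : ℂ) (x : Icc a b) :
    initialValueSol hab hp hq v z x =
      v + ∫ t in a..x, coeff p q z t (initialValueSol hab hp hq v z (projIcc a b hab t)) := by
  have h := congrArg (· (ContinuousMap.const (Icc a b) v)) (Ring.mul_inverse_cancel _
    (isUnit_one_sub_volterra hab (intervalIntegrable_coeff hab hp hq z)))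
  have h' : initialValueSol hab hp hq v z -
      volterra hab (intervalIntegrable_coeff hab hp hq z) (initialValueSol hab hp hq v z) =
      ContinuousMap.const (Icc a b) v := h
  have := congrArg (· x) h'
  simp only [ContinuousMap.sub_apply, volterra_apply, ContinuousMap.const_apply] at this
  exact sub_eq_iff_eq_add.1 this

theorem exists_absCont_sol (hab : a ≤ b) (hp : IntegrableOn p (Icc a b))
    (hq : IntegrableOn q (Icc a b)) (v : EuclideanSpace ℂ (Fin 2)) (z : ℂ) :
    ∃ U : ℝ → EuclideanSpace ℂ (Fin 2), AbsolutelyContinuousOnInterval U a b ∧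
      (∀ᵐ x ∂(volume.restrict (Icc a b)), diffExpr p q U x = z • U x) ∧ U a = v := by
  have hi := intervalIntegrable_clm_apply_projIcc hab (intervalIntegrable_coeff hab hp hq z)
    (initialValueSol hab hp hq v z)
  refine ⟨fun x => (∫ t in a..x, coeff p q z t (initialValueSol hab hp hq v z (projIcc a b hab t)))
    + v, hi.absolutelyContinuousOnInterval_integral.of_dist_le fun x _ y _ => by simp, ?_, by simp⟩
  rw [ae_restrict_iff' measurableSet_Icc]
  filter_upwards [hi.ae_hasDerivAt_integral] with x h1 hx
  rw [diffExpr_eq_smul_iff, ((h1 (by rwa [uIcc_of_le hab]) a left_mem_uIcc).add_const v).deriv,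
    projIcc_of_mem hab hx, initialValueSol_apply, add_comm]

/-- Integrating the equation gives `(1 - volterra) u = const`, and `1 - volterra` is invertible.
This uniqueness ties the fundamental matrix, obtained by choice separately for each `z`, to a family
continuous in `z`. -/
theorem sol_eq_initialValueSol (hab : a ≤ b) (hp : IntegrableOn p (Icc a b))
    (hq : IntegrableOn q (Icc a b)) {z : ℂ} {U : ℝ → EuclideanSpace ℂ (Fin 2)}
    (hU : AbsolutelyContinuousOnInterval U a b)
    (hd : ∀ᵐ x ∂(volume.restrict (Icc a b)), diffExpr p q U x = z • U x) (x : Icc a b) :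
    U x = initialValueSol hab hp hq (U a) z x := by
  have hc := hU.continuousOn
  rw [uIcc_of_le hab] at hc
  set u : C(Icc a b, EuclideanSpace ℂ (Fin 2)) := ⟨fun x => U x, hc.domRestrict⟩ with hu
  have hi := intervalIntegrable_clm_apply_projIcc hab (intervalIntegrable_coeff hab hp hq z) u
  have h1 : (1 - volterra hab (intervalIntegrable_coeff hab hp hq z)) u =
      ContinuousMap.const (Icc a b) (U a) := by
    ext1 x
    have h2 := hU.eq_add_integral hab hi ?_ x.2
    · exact sub_eq_iff_eq_add.2 h2
    · have hm : ∀ᵐ x ∂(volume.restrict (Icc a b)), x ∈ Icc a b :=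
        ae_restrict_mem measurableSet_Icc
      filter_upwards [hd, ae_differentiableAt hU, hm] with x h1 h2 h3
      rw [diffExpr_eq_smul_iff] at h1
      rw [projIcc_of_mem hab h3]
      exact h1 ▸ h2.hasDerivAt
  have h2 := congrArg (· u) (Ring.inverse_mul_cancel _
    (isUnit_one_sub_volterra hab (intervalIntegrable_coeff hab hp hq z)))
  have h3 : Ring.inverse (1 - volterra hab (intervalIntegrable_coeff hab hp hq z))
    ((1 - volterra hab (intervalIntegrable_coeff hab hp hq z)) u) = u := h2
  rw [h1] at h3
  exact (congrArg (· x) h3).symm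

theorem isFundamentalMatrix_fundamentalMatrix (hab : a ≤ b) (hp : IntegrableOn p (Icc a b))
    (hq : IntegrableOn q (Icc a b)) (z : ℂ) :
    IsFundamentalMatrix a b p q z (fundamentalMatrix a b p q z) := by
  have h : ∃ Y, IsFundamentalMatrix a b p q z Y := by
    choose U h1 h2 h3 using fun k : Fin 2 =>
      exists_absCont_sol hab hp hq (EuclideanSpace.single k (1 : ℂ)) z
    refine ⟨fun x => Matrix.of fun i j => U j x i, h1, h2, ?_⟩
    ext i j
    simp [h3, Matrix.one_apply]
  rw [fundamentalMatrix, dif_pos h]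
  exact h.choose_spec

/-- The `k`-th column of the fundamental matrix. -/
def fundamentalCol (a b : ℝ) (p q : ℝ → ℝ) (k : Fin 2) (z : ℂ) (x : ℝ) :
    EuclideanSpace ℂ (Fin 2) :=
  WithLp.toLp 2 ((fundamentalMatrix a b p q z x).col k)

theorem absCont_fundamentalCol (hab : a ≤ b) (hp : IntegrableOn p (Icc a b))
    (hq : IntegrableOn q (Icc a b)) (k : Fin 2) (z : ℂ) :
    AbsolutelyContinuousOnInterval (fundamentalCol a b p q k z) a b :=
  (isFundamentalMatrix_fundamentalMatrix hab hp hq z).absCont k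

theorem diffExpr_fundamentalCol (hab : a ≤ b) (hp : IntegrableOn p (Icc a b))
    (hq : IntegrableOn q (Icc a b)) (k : Fin 2) (z : ℂ) :
    ∀ᵐ x ∂(volume.restrict (Icc a b)), diffExpr p q (fundamentalCol a b p q k z) x =
      z • fundamentalCol a b p q k z x :=
  (isFundamentalMatrix_fundamentalMatrix hab hp hq z).ode k

theorem fundamentalCol_left (hab : a ≤ b) (hp : IntegrableOn p (Icc a b))
    (hq : IntegrableOn q (Icc a b)) (k : Fin 2) (z : ℂ) :
    fundamentalCol a b p q k z a = EuclideanSpace.single k 1 := by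
  ext i
  simp [fundamentalCol, (isFundamentalMatrix_fundamentalMatrix hab hp hq z).init,
    Matrix.one_apply]

theorem fundamentalCol_eq (hab : a ≤ b) (hp : IntegrableOn p (Icc a b))
    (hq : IntegrableOn q (Icc a b)) (k : Fin 2) (z : ℂ) (x : Icc a b) :
    fundamentalCol a b p q k z x =
      initialValueSol hab hp hq (EuclideanSpace.single k 1) z x := by
  rw [sol_eq_initialValueSol hab hp hq (absCont_fundamentalCol hab hp hq k z)
    (diffExpr_fundamentalCol hab hp hq k z) x, fundamentalCol_left hab hp hq]

end Fundamental

end DiracKrein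

/-! ### Trace class criteria -/

section TraceClass

open Filter Topology

/-- Distinct members lie at distance `√2`, so the balls of radius `1/2` around them are disjoint
open sets in a separable space. -/
theorem Orthonormal.countable {𝕜 E ι : Type*} [RCLike 𝕜] [NormedAddCommGroup E]
    [InnerProductSpace 𝕜 E] [TopologicalSpace.SeparableSpace E] {e : ι → E}
    (he : Orthonormal 𝕜 e) : Countable ι := by
  rw [← Set.countable_univ_iff]
  refine Set.PairwiseDisjoint.countable_of_isOpen (s := fun i => Metric.ball (e i) (1 / 2)) ?_
    (fun i _ => Metric.isOpen_ball) (fun i _ => ⟨e i, Metric.mem_ball_self (by norm_num)⟩)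
  intro i _ j _ hij
  refine Metric.ball_disjoint_ball ?_
  have h : ‖e i - e j‖ ^ 2 = 2 := by
    rw [@norm_sub_sq 𝕜, he.1, he.1, he.2 hij]
    norm_num
  rw [dist_eq_norm]
  nlinarith [norm_nonneg (e i - e j)]

variable {H : Type*} [NormedAddCommGroup H] [InnerProductSpace ℂ H] [CompleteSpace H]

/-- Approximate polar decomposition. -/
theorem exists_norm_le_one_norm_adjoint_mul_sub_abs_le (A : H →L[ℂ] H) {ε : ℝ} (hε : 0 < ε) :
    ∃ U : H →L[ℂ] H, ‖U‖ ≤ 1 ∧ ‖star U * A - CFC.abs A‖ ≤ ε := by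
  have hS : IsSelfAdjoint (CFC.abs A) := (CFC.abs_nonneg A).isSelfAdjoint
  have hpos : ∀ t : ℝ, |t| + ε ≠ 0 := fun t => by positivity
  have hc : Continuous fun t : ℝ => 1 / (|t| + ε) :=
    continuous_const.div (by fun_prop) hpos
  have hc2 : Continuous fun t : ℝ => 1 / (|t| + ε) * (t * t) := hc.mul (by fun_prop)
  -- `W` is `(|A| + ε)⁻¹`, and `U` will be `A W`. The two estimates are `t² / (t + ε)² ≤ 1` and `|t²
  -- / (t + ε) - t| = tε / (t + ε) ≤ ε` on the spectrum; `|t|` in place of `t` keeps the function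
  -- continuous on all of `ℝ`.
  set W := cfc (fun t : ℝ => 1 / (|t| + ε)) (CFC.abs A) with hW
  have hWs : star W = W := (cfc_predicate _ _ : IsSelfAdjoint W)
  have h1 : W * (star A * A) = cfc (fun t : ℝ => 1 / (|t| + ε) * (t * t)) (CFC.abs A) := by
    have e : CFC.abs A = cfc (fun t : ℝ => t) (CFC.abs A) := (cfc_id' ℝ _).symm
    rw [← CFC.abs_mul_abs A, hW, cfc_mul _ _ _ hc.continuousOn (by fun_prop),
      cfc_mul (fun t : ℝ => t) (fun t => t), ← e]
  refine ⟨A * W, ?_, ?_⟩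
  · have h2 : star (A * W) * (A * W) =
        cfc (fun t : ℝ => 1 / (|t| + ε) * (t * t) * (1 / (|t| + ε))) (CFC.abs A) := by
      rw [cfc_mul _ _ _ hc2.continuousOn
        hc.continuousOn, ← h1, star_mul, hWs, ← hW]
      simp only [mul_assoc]
    have h3 : ‖star (A * W) * (A * W)‖ ≤ 1 := by
      rw [h2]
      refine norm_cfc_le zero_le_one fun t _ => ?_
      have h := abs_nonneg t
      have h0 : 0 < |t| + ε := by positivity
      rw [← abs_mul_abs_self t]
      have e : 1 / (|t| + ε) * (|t| * |t|) * (1 / (|t| + ε)) = (|t| / (|t| + ε)) ^ 2 := by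
        field_simp
      rw [e, Real.norm_of_nonneg (by positivity)]
      exact pow_le_one₀ (by positivity) ((div_le_one h0).2 (by linarith))
    rw [CStarRing.norm_star_mul_self] at h3
    nlinarith [norm_nonneg (A * W)]
  · rw [star_mul, hWs, mul_assoc, h1]
    nth_rewrite 2 [← cfc_id' ℝ (CFC.abs A)]
    rw [← cfc_sub _ _ _ hc2.continuousOn (by fun_prop)]
    refine norm_cfc_le hε.le fun t ht => ?_
    have h0 : 0 ≤ t := spectrum_nonneg_of_nonneg (CFC.abs_nonneg A) ht
    have h : 0 < t + ε := by positivity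
    rw [abs_of_nonneg h0]
    have e : 1 / (t + ε) * (t * t) - t = -(t * ε / (t + ε)) := by
      field_simp
      ring
    rw [e, norm_neg, Real.norm_of_nonneg (by positivity), div_le_iff₀ h]
    nlinarith

/-- With `|A| ≈ U* S* R`, the diagonal entry of `|A|` at `e` is close to `⟨S U e, R e⟩`, which is at
most `(‖S U e‖² + ‖R e‖²) / 2` in modulus. The contraction `U` varies with the finite set, whence
the uniformity demanded in `hS`. -/
theorem DiracKrein.isTraceClass_of_sum_norm_sq_le.{u} {H : Type u} [NormedAddCommGroup H]
    [InnerProductSpace ℂ H] [CompleteSpace H] {S R : H →L[ℂ] H} {C D : ℝ}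
    (hS : ∀ (U : H →L[ℂ] H), ‖U‖ ≤ 1 → ∀ {ι : Type u} (e : ι → H), Orthonormal ℂ e →
      ∀ s : Finset ι, ∑ i ∈ s, ‖S (U (e i))‖ ^ 2 ≤ C)
    (hR : ∀ {ι : Type u} (e : ι → H), Orthonormal ℂ e →
      ∀ s : Finset ι, ∑ i ∈ s, ‖R (e i)‖ ^ 2 ≤ D) :
    DiracKrein.IsTraceClass (star S * R) := by
  intro ι e
  set A := star S * R with hA
  refine summable_of_sum_le (c := (C + D) / 2) (fun i => ?_) fun s => ?_
  · have h := (ContinuousLinearMap.nonneg_iff_isPositive _).1 (CFC.abs_nonneg A)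
    exact h.re_inner_nonneg_right _
  · refine le_of_forall_pos_le_add fun δ hδ => ?_
    -- This tolerance keeps the total error over `s` below `δ`; the `+ 1` covers empty `s`.
    obtain ⟨U, hU, hUA⟩ := exists_norm_le_one_norm_adjoint_mul_sub_abs_le A
      (ε := δ / (s.card + 1)) (by positivity)
    have h1 : ∀ i, (inner ℂ (e i) (CFC.abs A (e i))).re ≤
        (‖S (U (e i))‖ ^ 2 + ‖R (e i)‖ ^ 2) / 2 + δ / (s.card + 1) := by
      intro i
      have e1 : inner ℂ (e i) (CFC.abs A (e i)) = inner ℂ (S (U (e i))) (R (e i)) -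
          inner ℂ (e i) ((star U * A - CFC.abs A) (e i)) := by
        simp only [_root_.sub_apply, inner_sub_right, hA, mul_apply_eq_comp,
          ContinuousLinearMap.star_eq_adjoint, ContinuousLinearMap.adjoint_inner_right]
        ring
      have e2 := norm_inner_le_norm (𝕜 := ℂ) (S (U (e i))) (R (e i))
      have e3 := norm_inner_le_norm (𝕜 := ℂ) (e i) ((star U * A - CFC.abs A) (e i))
      have e4 := (star U * A - CFC.abs A).le_opNorm (e i)
      rw [e.orthonormal.1 i, one_mul] at e3
      rw [e.orthonormal.1 i, mul_one] at e4
      have e5 := Complex.re_le_norm (inner ℂ (S (U (e i))) (R (e i)))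
      have e6 := (abs_le.1 (Complex.abs_re_le_norm
        (inner ℂ (e i) ((star U * A - CFC.abs A) (e i))))).1
      rw [e1, Complex.sub_re]
      nlinarith [sq_nonneg (‖S (U (e i))‖ - ‖R (e i)‖)]
    refine (Finset.sum_le_sum fun i _ => h1 i).trans ?_
    rw [Finset.sum_add_distrib, ← Finset.sum_div, Finset.sum_add_distrib, Finset.sum_const,
      nsmul_eq_mul]
    have h2 := hS U hU e e.orthonormal s
    have h3 := hR e e.orthonormal s
    have h4 : (s.card : ℝ) * (δ / (s.card + 1)) ≤ δ := by
      rw [mul_div_assoc', div_le_iff₀ (by positivity)]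
      nlinarith
    linarith

end TraceClass

namespace DiracKrein

/-! ### Integral operators with bounded kernels -/

section Kernel

open Filter Topology

variable {X : Type*} [MeasurableSpace X] {μ : Measure X}

/-- `R` is an integral operator on `L²(μ, ℂ²)` whose rows `g x k` are bounded in `L²`. -/
structure HasRowKernel
    (R : Lp (EuclideanSpace ℂ (Fin 2)) 2 μ →L[ℂ] Lp (EuclideanSpace ℂ (Fin 2)) 2 μ)
    (g : X → Fin 2 → Lp (EuclideanSpace ℂ (Fin 2)) 2 μ) (C : ℝ) : Prop where
  apply_eq : ∀ f, ∀ᵐ x ∂μ, ∀ k, R f x k = inner ℂ (g x k) f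
  norm_le : ∀ᵐ x ∂μ, ∀ k, ‖g x k‖ ≤ C

theorem norm_sq_eq_integral (f : Lp (EuclideanSpace ℂ (Fin 2)) 2 μ) :
    Integrable (fun x => ∑ k, ‖f x k‖ ^ 2) μ ∧ ‖f‖ ^ 2 = ∫ x, ∑ k, ‖f x k‖ ^ 2 ∂μ := by
  have h : ∀ x, inner ℂ (f x) (f x) = ((∑ k, ‖f x k‖ ^ 2 : ℝ) : ℂ) := fun x => by
    rw [inner_self_eq_norm_sq_to_K, ← EuclideanSpace.norm_sq_eq]
    norm_cast
  have h1 := L2.integrable_inner (𝕜 := ℂ) f f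
  simp only [h] at h1
  refine ⟨h1.re, ?_⟩
  have h2 := L2.inner_def (𝕜 := ℂ) f f
  simp only [h] at h2
  rw [inner_self_eq_norm_sq_to_K, integral_complex_ofReal] at h2
  refine Complex.ofReal_injective ?_
  rw [Complex.ofReal_pow]
  exact h2

variable {R S : Lp (EuclideanSpace ℂ (Fin 2)) 2 μ →L[ℂ] Lp (EuclideanSpace ℂ (Fin 2)) 2 μ}
  {g h : X → Fin 2 → Lp (EuclideanSpace ℂ (Fin 2)) 2 μ} {C D : ℝ}

/-- For almost every `x`, Bessel's inequality is applied to the vectors `U* (g x k)`, whose norm is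
at most `C`; the factor `2` counts the components `k`. -/
theorem HasRowKernel.sum_norm_sq_le [IsFiniteMeasure μ] (hR : HasRowKernel R g C)
    {U : Lp (EuclideanSpace ℂ (Fin 2)) 2 μ →L[ℂ] Lp (EuclideanSpace ℂ (Fin 2)) 2 μ} (hU : ‖U‖ ≤ 1)
    {ι : Type*} (e : ι → Lp (EuclideanSpace ℂ (Fin 2)) 2 μ) (he : Orthonormal ℂ e) (s : Finset ι) :
    ∑ i ∈ s, ‖R (U (e i))‖ ^ 2 ≤ 2 * C ^ 2 * μ.real univ := by
  have h1 := fun i => norm_sq_eq_integral (R (U (e i)))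
  rw [Finset.sum_congr rfl fun i _ => (h1 i).2, ← integral_finsetSum _ fun i _ => (h1 i).1,
    mul_comm]
  refine (integral_mono_ae (integrable_finsetSum _ fun i _ => (h1 i).1)
    (integrable_const (2 * C ^ 2)) ?_).trans_eq (by simp)
  have h2 : ∀ᵐ x ∂μ, ∀ i ∈ s, ∀ k, R (U (e i)) x k = inner ℂ (g x k) (U (e i)) :=
    (Finset.eventually_all s).2 fun i _ => hR.apply_eq _
  filter_upwards [h2, hR.norm_le] with x h3 h4
  rw [Finset.sum_comm]
  have h5 : ∀ k, ∑ i ∈ s, ‖R (U (e i)) x k‖ ^ 2 ≤ C ^ 2 := by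
    intro k
    rw [Finset.sum_congr rfl fun i hi => by rw [h3 i hi k]]
    have h6 := he.sum_inner_products_le (s := s) (star U (g x k))
    have h7 : ‖star U (g x k)‖ ≤ C := by
      refine ((star U).le_opNorm _).trans ?_
      rw [ContinuousLinearMap.star_eq_adjoint, LinearIsometryEquiv.norm_map]
      nlinarith [h4 k, norm_nonneg (g x k)]
    refine le_trans (le_of_eq ?_) (h6.trans (pow_le_pow_left₀ (norm_nonneg _) h7 2))
    refine Finset.sum_congr rfl fun i _ => ?_
    rw [ContinuousLinearMap.star_eq_adjoint, ContinuousLinearMap.adjoint_inner_right,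
      norm_inner_symm]
  rw [Fin.sum_univ_two]
  linarith [h5 0, h5 1]

theorem norm_sum_inner_mul_inner_le {H ι : Type*} [NormedAddCommGroup H] [InnerProductSpace ℂ H]
    {e : ι → H} (he : Orthonormal ℂ e) (x y : H) (s : Finset ι) :
    ‖∑ i ∈ s, inner ℂ x (e i) * inner ℂ (e i) y‖ ≤ (‖x‖ ^ 2 + ‖y‖ ^ 2) / 2 := by
  have h1 := he.sum_inner_products_le (s := s) x
  have h2 := he.sum_inner_products_le (s := s) y
  have h3 : ∀ i, ‖inner ℂ x (e i) * inner ℂ (e i) y‖ ≤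
      (‖inner ℂ (e i) x‖ ^ 2 + ‖inner ℂ (e i) y‖ ^ 2) / 2 := fun i => by
    rw [norm_mul, norm_inner_symm x]
    nlinarith [sq_nonneg (‖inner ℂ (e i) x‖ - ‖inner ℂ (e i) y‖)]
  refine (norm_sum_le _ _).trans ((Finset.sum_le_sum fun i _ => h3 i).trans ?_)
  rw [← Finset.sum_div, Finset.sum_add_distrib]
  linarith

/-- Each diagonal entry is the integral of `∑ₖ ⟨g, e⟩⟨e, h⟩`, and for fixed `x` Parseval sums this
over the basis. Bessel bounds all finite partial sums by one constant, so dominated convergence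
exchanges sum and integral. -/
theorem HasRowKernel.hasTrace {X : Type} [MeasurableSpace X] {μ : Measure X}
    {R S : Lp (EuclideanSpace ℂ (Fin 2)) 2 μ →L[ℂ] Lp (EuclideanSpace ℂ (Fin 2)) 2 μ}
    {g h : X → Fin 2 → Lp (EuclideanSpace ℂ (Fin 2)) 2 μ} {C D : ℝ} [IsFiniteMeasure μ]
    [TopologicalSpace.SeparableSpace (Lp (EuclideanSpace ℂ (Fin 2)) 2 μ)]
    (hS : HasRowKernel S h C) (hR : HasRowKernel R g D) :
    HasTrace (star S * R) (∫ x, ∑ k, inner ℂ (g x k) (h x k) ∂μ) := by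
  refine ⟨isTraceClass_of_sum_norm_sq_le (C := 2 * C ^ 2 * μ.real univ)
    (D := 2 * D ^ 2 * μ.real univ) (fun U hU ι e he s => hS.sum_norm_sq_le hU e he s)
    (fun {ι} e he s => ?_), fun ι e => ?_⟩
  · exact hR.sum_norm_sq_le (U := 1) ContinuousLinearMap.norm_id_le e he s
  -- Countability serves twice: to intersect the almost-everywhere statements over `i`, and to make
  -- the filter of finite sets countably generated for dominated convergence.
  · have : Countable ι := e.orthonormal.countable
    have h1 : ∀ i, inner ℂ (e i) ((star S * R) (e i)) =
        ∫ x, inner ℂ (S (e i) x) (R (e i) x) ∂μ := fun i => by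
      rw [mul_apply_eq_comp, ContinuousLinearMap.star_eq_adjoint,
        ContinuousLinearMap.adjoint_inner_right, L2.inner_def]
    have h2 : ∀ᵐ x ∂μ, ∀ i, inner ℂ (S (e i) x) (R (e i) x) =
        ∑ k, inner ℂ (g x k) (e i) * inner ℂ (e i) (h x k) := by
      filter_upwards [ae_all_iff.2 fun i => hS.apply_eq (e i),
        ae_all_iff.2 fun i => hR.apply_eq (e i)] with x h3 h4 i
      simp only [PiLp.inner_apply, h3 i, h4 i, RCLike.inner_apply, inner_conj_symm]
    simp only [HasSum, h1]
    have h3 : ∀ s : Finset ι, ∑ i ∈ s, ∫ x, inner ℂ (S (e i) x) (R (e i) x) ∂μ =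
        ∫ x, ∑ i ∈ s, inner ℂ (S (e i) x) (R (e i) x) ∂μ := fun s =>
      (integral_finsetSum _ fun i _ => L2.integrable_inner _ _).symm
    simp only [h3]
    refine tendsto_integral_filter_of_dominated_convergence (fun _ => C ^ 2 + D ^ 2)
      (Eventually.of_forall fun s => (integrable_finsetSum _ fun i _ =>
        L2.integrable_inner _ _).aestronglyMeasurable) (Eventually.of_forall fun s => ?_)
      (integrable_const _) ?_
    · filter_upwards [h2, hS.norm_le, hR.norm_le] with x h4 h5 h6
      rw [Finset.sum_congr rfl fun i _ => h4 i, Finset.sum_comm, Fin.sum_univ_two]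
      refine (norm_add_le _ _).trans ?_
      have h7 := fun k => norm_sum_inner_mul_inner_le e.orthonormal (g x k) (h x k) s
      have h8 := fun k => pow_le_pow_left₀ (norm_nonneg _) (h5 k) 2
      have h9 := fun k => pow_le_pow_left₀ (norm_nonneg _) (h6 k) 2
      linarith [h7 0, h7 1, h8 0, h8 1, h9 0, h9 1]
    · filter_upwards [h2] with x h4
      simp only [h4]
      exact hasSum_sum fun k _ => e.hasSum_inner_mul_inner (g x k) (h x k)

instance separableSpace_L2 (a b : ℝ) : TopologicalSpace.SeparableSpace (L2 a b) := by
  have : Fact ((2 : ENNReal) ≠ ⊤) := ⟨by simp⟩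
  infer_instance

end Kernel

/-! ### The solution satisfying the boundary condition at `b` -/

section WeylSolution

open Filter Topology

variable {a b : ℝ} {p q : ℝ → ℝ} {α : ℝ}

/-- The numerator of the Weyl–Titchmarsh function. -/
def weylNumerator (a b : ℝ) (p q : ℝ → ℝ) (α : ℝ) (z : ℂ) : ℂ :=
  fundamentalMatrix a b p q z b 0 0 * (Real.cos α : ℂ) +
    fundamentalMatrix a b p q z b 1 0 * (Real.sin α : ℂ)

/-- The solution with value `(sin α, -cos α)` at `b`. -/
def rightSol (a b : ℝ) (p q : ℝ → ℝ) (α : ℝ) (z : ℂ) : ℝ → EuclideanSpace ℂ (Fin 2) :=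
  c a b p q α z • fundamentalCol a b p q 0 z +
    (-weylNumerator a b p q α z) • fundamentalCol a b p q 1 z

theorem c_eq (z : ℂ) : c a b p q α z = fundamentalCol a b p q 1 z b 0 * (Real.cos α : ℂ) +
    fundamentalCol a b p q 1 z b 1 * (Real.sin α : ℂ) := rfl

theorem weylNumerator_eq (z : ℂ) : weylNumerator a b p q α z =
    fundamentalCol a b p q 0 z b 0 * (Real.cos α : ℂ) +
      fundamentalCol a b p q 0 z b 1 * (Real.sin α : ℂ) := rfl

theorem rightSol_apply (z : ℂ) (x : ℝ) (k : Fin 2) : rightSol a b p q α z x k =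
    c a b p q α z * fundamentalCol a b p q 0 z x k -
      weylNumerator a b p q α z * fundamentalCol a b p q 1 z x k := by
  simp [rightSol, sub_eq_add_neg]

theorem absCont_smul_add_smul {u v : ℝ → EuclideanSpace ℂ (Fin 2)}
    (hu : AbsolutelyContinuousOnInterval u a b) (hv : AbsolutelyContinuousOnInterval v a b)
    (s t : ℂ) : AbsolutelyContinuousOnInterval (s • u + t • v) a b :=
  AbsolutelyContinuousOnInterval.add (hu.const_smul s) (hv.const_smul t)

theorem absCont_rightSol (hab : a ≤ b) (hp : IntegrableOn p (Icc a b))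
    (hq : IntegrableOn q (Icc a b)) (z : ℂ) :
    AbsolutelyContinuousOnInterval (rightSol a b p q α z) a b :=
  absCont_smul_add_smul (absCont_fundamentalCol hab hp hq 0 z)
    (absCont_fundamentalCol hab hp hq 1 z) _ _

theorem diffExpr_rightSol (hab : a ≤ b) (hp : IntegrableOn p (Icc a b))
    (hq : IntegrableOn q (Icc a b)) (z : ℂ) :
    ∀ᵐ x ∂(volume.restrict (Icc a b)), diffExpr p q (rightSol a b p q α z) x =
      z • rightSol a b p q α z x := by
  have h0 := absCont_fundamentalCol hab hp hq 0 z
  have h1 := absCont_fundamentalCol hab hp hq 1 z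
  filter_upwards [diffExpr_add (p := p) (q := q) (h0.const_smul (c a b p q α z))
      (h1.const_smul (-weylNumerator a b p q α z)),
    diffExpr_smul (p := p) (q := q) (c a b p q α z) h0,
    diffExpr_smul (p := p) (q := q) (-weylNumerator a b p q α z) h1,
    diffExpr_fundamentalCol hab hp hq 0 z, diffExpr_fundamentalCol hab hp hq 1 z]
    with x e1 e2 e3 e4 e5
  refine e1.trans ?_
  rw [Pi.add_apply]
  refine (congrArg₂ _ e2 e3).trans ?_
  simp only [rightSol, Pi.add_apply, Pi.smul_apply, e4, e5, smul_add]
  rw [smul_comm z, smul_comm z]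

theorem wronskian_eq_add_integral (hab : a ≤ b) {u F : ℝ → EuclideanSpace ℂ (Fin 2)} {z w : ℂ}
    (hu : AbsolutelyContinuousOnInterval u a b) (hF : AbsolutelyContinuousOnInterval F a b)
    (hdu : ∀ᵐ x ∂(volume.restrict (Icc a b)), diffExpr p q u x = z • u x)
    (hdF : ∀ᵐ x ∂(volume.restrict (Icc a b)), diffExpr p q F x = w • F x)
    {x y : ℝ} (hx : x ∈ Icc a b) (hy : y ∈ Icc a b) :
    wronskian (u y) (F y) - wronskian (u x) (F x) =
      (z - w) * ∫ t in x..y, dot (u t) (F t) := by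
  have := lagrange (p := p) (q := q) (z := z) (w := w) hab hu hF (f := 0) (g := 0)
    integrableOn_zero integrableOn_zero
    (by simpa using hdu) (by simpa using hdF) hx hy
  rw [this, ← intervalIntegral.integral_const_mul]
  simp [dot]

/-- This Wronskian is the determinant of the fundamental matrix, constant by Lagrange's identity
with equal parameters. -/
theorem wronskian_fundamentalCol (hab : a ≤ b) (hp : IntegrableOn p (Icc a b))
    (hq : IntegrableOn q (Icc a b)) (z : ℂ) {x : ℝ} (hx : x ∈ Icc a b) :
    wronskian (fundamentalCol a b p q 1 z x) (fundamentalCol a b p q 0 z x) = 1 := by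
  have h := wronskian_eq_add_integral hab (absCont_fundamentalCol hab hp hq 1 z)
    (absCont_fundamentalCol hab hp hq 0 z) (diffExpr_fundamentalCol hab hp hq 1 z)
    (diffExpr_fundamentalCol hab hp hq 0 z) (left_mem_Icc.2 hab) hx
  rw [sub_self, zero_mul, sub_eq_zero] at h
  rw [h]
  simp [wronskian, fundamentalCol_left hab hp hq]

theorem wronskian_rightSol (hab : a ≤ b) (hp : IntegrableOn p (Icc a b))
    (hq : IntegrableOn q (Icc a b)) (z : ℂ) {x : ℝ} (hx : x ∈ Icc a b) :
    wronskian (fundamentalCol a b p q 1 z x) (rightSol a b p q α z x) = c a b p q α z := by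
  have h := wronskian_fundamentalCol hab hp hq z hx
  simp only [wronskian, rightSol_apply] at h ⊢
  linear_combination c a b p q α z * h

theorem rightSol_right (hab : a ≤ b) (hp : IntegrableOn p (Icc a b))
    (hq : IntegrableOn q (Icc a b)) (z : ℂ) :
    rightSol a b p q α z b 0 = Real.sin α ∧ rightSol a b p q α z b 1 = -Real.cos α := by
  have h := wronskian_fundamentalCol hab hp hq z (right_mem_Icc.2 hab)
  simp only [wronskian] at h
  constructor
  · rw [rightSol_apply, c_eq, weylNumerator_eq]
    linear_combination (Real.sin α : ℂ) * h
  · rw [rightSol_apply, c_eq, weylNumerator_eq]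
    linear_combination -(Real.cos α : ℂ) * h

theorem continuousOn_fundamentalCol (hab : a ≤ b) (hp : IntegrableOn p (Icc a b))
    (hq : IntegrableOn q (Icc a b)) (k : Fin 2) (z : ℂ) :
    ContinuousOn (fundamentalCol a b p q k z) (Icc a b) :=
  uIcc_of_le hab ▸ (absCont_fundamentalCol hab hp hq k z).continuousOn

theorem continuousOn_rightSol (hab : a ≤ b) (hp : IntegrableOn p (Icc a b))
    (hq : IntegrableOn q (Icc a b)) (z : ℂ) :
    ContinuousOn (rightSol a b p q α z) (Icc a b) :=
  uIcc_of_le hab ▸ (absCont_rightSol hab hp hq z).continuousOn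

/-- The Wronskian of `φ_z` and `ψ_w` is `c z` at `b`, by the value of `ψ_w` there, and `c w` at `a`,
because `φ_z` and `φ_w` have the same initial value. -/
theorem c_sub (hab : a ≤ b) (hp : IntegrableOn p (Icc a b)) (hq : IntegrableOn q (Icc a b))
    (z w : ℂ) : c a b p q α z - c a b p q α w =
      (z - w) * ∫ t in a..b, dot (fundamentalCol a b p q 1 z t) (rightSol a b p q α w t) := by
  rw [← wronskian_eq_add_integral hab (absCont_fundamentalCol hab hp hq 1 z)
    (absCont_rightSol hab hp hq w) (diffExpr_fundamentalCol hab hp hq 1 z)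
    (diffExpr_rightSol hab hp hq w) (left_mem_Icc.2 hab) (right_mem_Icc.2 hab),
    fundamentalCol_left hab hp hq, ← fundamentalCol_left hab hp hq 1 w,
    wronskian_rightSol hab hp hq w (left_mem_Icc.2 hab), wronskian,
    (rightSol_right hab hp hq w).1, (rightSol_right hab hp hq w).2, c_eq]
  ring

theorem norm_dot_le (u v : EuclideanSpace ℂ (Fin 2)) : ‖dot u v‖ ≤ 2 * (‖u‖ * ‖v‖) := by
  have h : ∀ k, ‖u k * v k‖ ≤ ‖u‖ * ‖v‖ := fun k => by
    rw [norm_mul]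
    exact mul_le_mul (PiLp.norm_apply_le u k) (PiLp.norm_apply_le v k) (norm_nonneg _)
      (norm_nonneg _)
  exact (norm_add_le _ _).trans (by linarith [h 0, h 1])

theorem hasDerivAt_c (hab : a ≤ b) (hp : IntegrableOn p (Icc a b)) (hq : IntegrableOn q (Icc a b))
    (w : ℂ) : HasDerivAt (c a b p q α)
      (∫ t in a..b, dot (fundamentalCol a b p q 1 w t) (rightSol a b p q α w t)) w := by
  have hs := (continuous_initialValueSol hab hp hq (EuclideanSpace.single 1 1)).tendsto w
  have hlim : Tendsto (fun z => ∫ t in a..b,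
      dot (fundamentalCol a b p q 1 z t) (rightSol a b p q α w t)) (𝓝 w)
      (𝓝 (∫ t in a..b, dot (fundamentalCol a b p q 1 w t) (rightSol a b p q α w t))) := by
    obtain ⟨D, hD⟩ := isCompact_Icc.exists_bound_of_continuousOn
      (continuousOn_rightSol (α := α) hab hp hq w)
    -- By continuity in the sup norm, this bounds `φ_z` on all of `[a, b]` for every `z` near `w`.
    set C := ‖initialValueSol hab hp hq (EuclideanSpace.single 1 1) w‖ + 1
    have hC : ∀ᶠ z in 𝓝 w, ∀ x ∈ Icc a b, ‖fundamentalCol a b p q 1 z x‖ ≤ C := by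
      filter_upwards [hs.norm.eventually_le_const (lt_add_one _)] with z hz x hx
      rw [fundamentalCol_eq hab hp hq 1 z ⟨x, hx⟩]
      exact (ContinuousMap.norm_coe_le_norm _ _).trans hz
    refine intervalIntegral.tendsto_integral_filter_of_dominated_convergence
      (fun _ => 2 * (C * D)) ?_ ?_ intervalIntegrable_const ?_
    · refine Eventually.of_forall fun z => ?_
      rw [uIoc_of_le hab]
      exact ((integrableOn_dot (continuousOn_fundamentalCol hab hp hq 1 z)
        ((continuousOn_rightSol hab hp hq w).integrableOn_compact isCompact_Icc)).mono_set
          Ioc_subset_Icc_self).aestronglyMeasurable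
    · filter_upwards [hC] with z hz
      refine Eventually.of_forall fun t ht => (norm_dot_le _ _).trans ?_
      rw [uIoc_of_le hab] at ht
      have ht' := Ioc_subset_Icc_self ht
      have h1 := hz t ht'
      have h2 := hD t ht'
      have h3 := (norm_nonneg _).trans h1
      gcongr
    · refine Eventually.of_forall fun t ht => ?_
      rw [uIoc_of_le hab] at ht
      have h1 : ∀ k, Tendsto (fun z => fundamentalCol a b p q 1 z t k) (𝓝 w)
          (𝓝 (fundamentalCol a b p q 1 w t k)) := fun k => by
        have h2 := fun z => fundamentalCol_eq hab hp hq 1 z ⟨t, Ioc_subset_Icc_self ht⟩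
        simp only [h2]
        exact ((EuclideanSpace.proj k : EuclideanSpace ℂ (Fin 2) →L[ℂ] ℂ).continuous.comp
          (continuous_eval_const _)).continuousAt.tendsto.comp hs
      exact ((h1 0).mul_const _).add ((h1 1).mul_const _)
  rw [hasDerivAt_iff_tendsto_slope]
  refine (hlim.mono_left nhdsWithin_le_nhds).congr' ?_
  filter_upwards [self_mem_nhdsWithin] with z hz
  rw [slope_def_field, c_sub hab hp hq, mul_div_cancel_left₀ _ (sub_ne_zero.2 hz)]

end WeylSolution

/-! ### The resolvent -/

section Resolvent

open Filter Topology

variable {a b : ℝ} {p q : ℝ → ℝ} {α : ℝ}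

theorem resolvent_spec {H : Type*} [NormedAddCommGroup H] [InnerProductSpace ℂ H]
    {T : H →ₗ.[ℂ] H} {z : ℂ} (hz : z ∈ resolventSet T) : IsResolvent T z (resolvent T z) := by
  rw [resolvent, dif_pos hz]
  exact Exists.choose_spec hz

/-- Apply `R` to `(T - z) S g = g - (z - w) S g`. -/
theorem IsResolvent.sub_eq {H : Type*} [NormedAddCommGroup H] [InnerProductSpace ℂ H]
    {T : H →ₗ.[ℂ] H} {z w : ℂ} {R S : H →L[ℂ] H} (hR : IsResolvent T z R)
    (hS : IsResolvent T w S) : R - S = (z - w) • (R * S) := by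
  ext g
  obtain ⟨h, e⟩ := hS.right_inv g
  have h1 : R (T ⟨S g, h⟩ - z • S g) = S g := hR.left_inv ⟨S g, h⟩
  rw [show T ⟨S g, h⟩ - z • S g = g - (z - w) • S g by rw [sub_eq_iff_eq_add.1 e]; module,
    map_sub, map_smul] at h1
  simp only [_root_.sub_apply, _root_.smul_apply, mul_apply_eq_comp]
  rw [sub_eq_iff_eq_add] at h1 ⊢
  rw [h1, add_comm]

theorem integrableOn_L2 (g : L2 a b) : IntegrableOn g (Icc a b) :=
  (Lp.memLp g).integrable (by norm_num)

theorem IsResolvent.exists_rep {z : ℂ} {R : L2 a b →L[ℂ] L2 a b}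
    (hR : IsResolvent (T a b p q α) z R) (g : L2 a b) :
    ∃ F : ℝ → EuclideanSpace ℂ (Fin 2), IsDomainRep a b p q α (R g) F ∧
      ∀ᵐ x ∂(volume.restrict (Icc a b)), diffExpr p q F x = z • F x + g x := by
  obtain ⟨h, e⟩ := hR.right_inv g
  obtain ⟨F, hF⟩ := id h
  refine ⟨F, hF, ?_⟩
  rw [T_apply ⟨R g, h⟩ hF, sub_eq_iff_eq_add] at e
  have e1 := hF.memLp.coeFn_toLp
  rw [e] at e1
  filter_upwards [e1, hF.ae_eq, Lp.coeFn_add g (z • R g), Lp.coeFn_smul z (R g)]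
    with x h1 h2 h3 h4
  rw [← h1, h3, Pi.add_apply, h4, Pi.smul_apply, h2, add_comm]

/-- Otherwise `φ_z` satisfies both boundary conditions and lies in the kernel of `T - z`. The left
inverse makes it zero almost everywhere, and by continuity at `a`, where its value is `(0, 1)`. -/
theorem c_ne_zero (hab : a < b) (hp : IntegrableOn p (Icc a b)) (hq : IntegrableOn q (Icc a b))
    {z : ℂ} {R : L2 a b →L[ℂ] L2 a b} (hR : IsResolvent (T a b p q α) z R) :
    c a b p q α z ≠ 0 := by
  intro hc
  have hcont := continuousOn_fundamentalCol hab.le hp hq 1 z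
  obtain ⟨C, hC⟩ := isCompact_Icc.exists_bound_of_continuousOn hcont
  have hm : MemLp (fundamentalCol a b p q 1 z) 2 (volume.restrict (Icc a b)) :=
    MemLp.of_bound (hcont.aestronglyMeasurable measurableSet_Icc) C
      ((ae_restrict_iff' measurableSet_Icc).2 (Eventually.of_forall hC))
  have hd := diffExpr_fundamentalCol hab.le hp hq 1 z
  have hF : IsDomainRep a b p q α hm.toLp (fundamentalCol a b p q 1 z) :=
    { ae_eq := hm.coeFn_toLp
      absCont := absCont_fundamentalCol hab.le hp hq 1 z
      memLp := (hm.const_smul z).ae_eq (EventuallyEq.symm hd)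
      bc_outer := by rw [← hc, c_eq]; ring
      bc_inner := by rw [fundamentalCol_left hab.le hp hq]; simp }
  have h1 := hR.left_inv ⟨hm.toLp, _, hF⟩
  rw [T_apply _ hF, show hF.memLp.toLp = z • hm.toLp from
    (MemLp.toLp_eq_toLp_iff hF.memLp (hm.const_smul z)).2 hd, sub_self, map_zero] at h1
  change 0 = hm.toLp at h1
  have h2 : fundamentalCol a b p q 1 z =ᵐ[volume.restrict (Icc a b)] 0 :=
    hm.coeFn_toLp.symm.trans (h1 ▸ Lp.coeFn_zero _ _ _)
  have h3 := Measure.eqOn_Icc_of_ae_eq volume hab.ne h2 hcont continuousOn_const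
    (left_mem_Icc.2 hab.le)
  have h4 := congrArg (· 1) h3
  simp [fundamentalCol_left hab.le hp hq] at h4

/-- The resolvent is symmetric for the bilinear pairing: the boundary conditions annihilate both
Wronskians in Lagrange's identity. This gives access to the adjoint without passing to the resolvent
at the conjugate of `z`. -/
theorem IsResolvent.integral_dot_comm (hab : a ≤ b) {z : ℂ} {R : L2 a b →L[ℂ] L2 a b}
    (hR : IsResolvent (T a b p q α) z R) (f g : L2 a b) :
    ∫ x in Icc a b, dot (R f x) (g x) = ∫ x in Icc a b, dot (f x) (R g x) := by
  obtain ⟨F, hF, hdF⟩ := hR.exists_rep f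
  obtain ⟨G, hG, hdG⟩ := hR.exists_rep g
  have h := lagrange hab hF.absCont hG.absCont (integrableOn_L2 f) (integrableOn_L2 g) hdF hdG
    (left_mem_Icc.2 hab) (right_mem_Icc.2 hab)
  have ha : wronskian (F a) (G a) = 0 := by simp [wronskian, hF.bc_inner, hG.bc_inner]
  have hb : wronskian (F b) (G b) = 0 := by
    -- `F b` and `G b` are both annihilated by the nonzero row `(cos α, sin α)`, so their
    -- determinant vanishes; `h1` certifies that the row is nonzero.
    have h1 : (Real.cos α : ℂ) ^ 2 + (Real.sin α : ℂ) ^ 2 = 1 := by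
      exact_mod_cast Real.cos_sq_add_sin_sq α
    have h2 := hF.bc_outer
    have h3 := hG.bc_outer
    simp only [wronskian]
    linear_combination (-(F b 1 * G b 0 - F b 0 * G b 1)) * h1 +
      (-(Real.cos α) * G b 1 + Real.sin α * G b 0) * h2 +
      (Real.cos α * F b 1 - Real.sin α * F b 0) * h3
  have hFc := hF.absCont.continuousOn
  have hGc := hG.absCont.continuousOn
  rw [uIcc_of_le hab] at hFc hGc
  have i1 := integrableOn_dot hFc (integrableOn_L2 g)
  have i2 := integrableOn_dot hGc (integrableOn_L2 f)
  simp only [dot_comm (G _)] at i2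
  rw [ha, hb, intervalIntegral.integral_of_le hab, ← integral_Icc_eq_integral_Ioc] at h
  simp only [sub_self, zero_mul, zero_add] at h
  rw [integral_sub i2 i1] at h
  rw [integral_congr_ae (g := fun x => dot (F x) (g x)),
    integral_congr_ae (f := fun x => dot (f x) (R g x)) (g := fun x => dot (f x) (G x))]
  · exact (sub_eq_zero.1 h.symm).symm
  · filter_upwards [hG.ae_eq] with x hx
    rw [hx]
  · filter_upwards [hF.ae_eq] with x hx
    rw [hx]

/-- The `k`-th row of Green's function `G(x, ·)`. -/
def greenRow (a b : ℝ) (p q : ℝ → ℝ) (α : ℝ) (z : ℂ) (x : ℝ) (k : Fin 2) (y : ℝ) :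
    EuclideanSpace ℂ (Fin 2) :=
  if y ≤ x then (-(rightSol a b p q α z x k) / c a b p q α z) • fundamentalCol a b p q 1 z y
  else (-(fundamentalCol a b p q 1 z x k) / c a b p q α z) • rightSol a b p q α z y

theorem setIntegral_ite_le {f g : ℝ → ℂ} (hf : IntegrableOn f (Icc a b))
    (hg : IntegrableOn g (Icc a b)) {x : ℝ} (hx : x ∈ Icc a b) :
    ∫ y in Icc a b, (if y ≤ x then f y else g y) = (∫ y in a..x, f y) + ∫ y in x..b, g y := by
  have h1 : EqOn (fun y => if y ≤ x then f y else g y) f (Ioc a x) := fun y hy => if_pos hy.2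
  have h2 : EqOn (fun y => if y ≤ x then f y else g y) g (Ioc x b) := fun y hy =>
    if_neg (not_le.2 hy.1)
  have i1 := hf.mono_set ((Ioc_subset_Ioc_right hx.2).trans Ioc_subset_Icc_self)
  have i2 := hg.mono_set ((Ioc_subset_Ioc_left hx.1).trans Ioc_subset_Icc_self)
  rw [integral_Icc_eq_integral_Ioc, ← Ioc_union_Ioc_eq_Ioc hx.1 hx.2,
    setIntegral_union (Ioc_disjoint_Ioc_of_le le_rfl) measurableSet_Ioc
      (i1.congr_fun h1.symm measurableSet_Ioc) (i2.congr_fun h2.symm measurableSet_Ioc),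
    setIntegral_congr_fun measurableSet_Ioc h1, setIntegral_congr_fun measurableSet_Ioc h2,
    intervalIntegral.integral_of_le hx.1, intervalIntegral.integral_of_le hx.2]

theorem smul_dot (s : ℂ) (u v : EuclideanSpace ℂ (Fin 2)) : dot (s • u) v = s * dot u v := by
  simp [dot]; ring

theorem dot_smul (s : ℂ) (u v : EuclideanSpace ℂ (Fin 2)) : dot u (s • v) = s * dot u v := by
  simp [dot]; ring

theorem greenRow_dot (z : ℂ) (x : ℝ) (k : Fin 2) (y : ℝ) (v : EuclideanSpace ℂ (Fin 2)) :
    dot (greenRow a b p q α z x k y) v = if y ≤ x then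
      (-(rightSol a b p q α z x k) / c a b p q α z) * dot (fundamentalCol a b p q 1 z y) v
    else (-(fundamentalCol a b p q 1 z x k) / c a b p q α z) * dot (rightSol a b p q α z y) v := by
  unfold greenRow
  split_ifs <;> rw [smul_dot]

/-- Lagrange's identity for `φ, F` on `[a, x]` and for `ψ, F` on `[x, b]` loses its boundary terms
at `a` and `b`. It thus expresses the Wronskians of `F` with `φ` and `ψ` at `x` through `g`, and
Cramer's rule with determinant `c z` recovers `F x`. -/
theorem IsResolvent.apply_eq_integral (hab : a < b) (hp : IntegrableOn p (Icc a b))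
    (hq : IntegrableOn q (Icc a b)) {z : ℂ} {R : L2 a b →L[ℂ] L2 a b}
    (hR : IsResolvent (T a b p q α) z R) (g : L2 a b) :
    ∀ᵐ x ∂(volume.restrict (Icc a b)), ∀ k,
      R g x k = ∫ y in Icc a b, dot (greenRow a b p q α z x k y) (g y) := by
  obtain ⟨F, hF, hdF⟩ := hR.exists_rep g
  have hc := c_ne_zero hab hp hq hR
  have hm : ∀ᵐ x ∂(volume.restrict (Icc a b)), x ∈ Icc a b := ae_restrict_mem measurableSet_Icc
  filter_upwards [hF.ae_eq, hm] with x hx hxm k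
  have i1 := integrableOn_dot (continuousOn_fundamentalCol hab.le hp hq 1 z) (integrableOn_L2 g)
  have i2 := integrableOn_dot (continuousOn_rightSol (α := α) hab.le hp hq z) (integrableOn_L2 g)
  simp only [greenRow_dot]
  rw [setIntegral_ite_le (i1.const_mul _) (i2.const_mul _) hxm,
    intervalIntegral.integral_const_mul, intervalIntegral.integral_const_mul, hx]
  have e1 := lagrange (p := p) (q := q) hab.le (absCont_fundamentalCol hab.le hp hq 1 z)
    hF.absCont (f := 0) integrableOn_zero (integrableOn_L2 g)
    (by simpa using diffExpr_fundamentalCol hab.le hp hq 1 z) hdF (left_mem_Icc.2 hab.le) hxm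
  have e2 := lagrange (p := p) (q := q) hab.le (absCont_rightSol (α := α) hab.le hp hq z)
    hF.absCont (f := 0) integrableOn_zero (integrableOn_L2 g)
    (by simpa using diffExpr_rightSol hab.le hp hq z) hdF hxm (right_mem_Icc.2 hab.le)
  have e3 : wronskian (fundamentalCol a b p q 1 z a) (F a) = 0 := by
    simp [wronskian, fundamentalCol_left hab.le hp hq, hF.bc_inner]
  have e4 : wronskian (rightSol a b p q α z b) (F b) = 0 := by
    rw [wronskian, (rightSol_right hab.le hp hq z).1, (rightSol_right hab.le hp hq z).2]
    linear_combination -hF.bc_outer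
  have e5 : ∀ v : EuclideanSpace ℂ (Fin 2), dot 0 v = 0 := fun v => by simp [dot]
  simp only [sub_self, zero_mul, Pi.zero_apply, e5, zero_add, zero_sub,
    intervalIntegral.integral_neg] at e1 e2
  rw [e3, sub_zero] at e1
  rw [e4, zero_sub, neg_inj] at e2
  rw [← e2, ← neg_eq_iff_eq_neg.2 e1]
  have e6 := wronskian_rightSol (α := α) hab.le hp hq z hxm
  field_simp
  rw [← e6]
  fin_cases k <;> simp only [wronskian] <;> simp <;> ring

end Resolvent

/-! ### Complex conjugation and the adjoint of the resolvent -/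

section Conjugation

open Filter Topology

variable {a b : ℝ} {p q : ℝ → ℝ} {α : ℝ}

/-- Entrywise complex conjugation on `ℂ²`. -/
def conjVec (v : EuclideanSpace ℂ (Fin 2)) : EuclideanSpace ℂ (Fin 2) := WithLp.toLp 2 (star v.ofLp)

@[simp]
theorem conjVec_apply (v : EuclideanSpace ℂ (Fin 2)) (k : Fin 2) : conjVec v k = star (v k) := rfl

@[simp]
theorem conjVec_conjVec (v : EuclideanSpace ℂ (Fin 2)) : conjVec (conjVec v) = v := by
  ext k
  simp

theorem norm_conjVec (v : EuclideanSpace ℂ (Fin 2)) : ‖conjVec v‖ = ‖v‖ := by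
  simp [EuclideanSpace.norm_eq]

theorem continuous_conjVec : Continuous conjVec := by
  unfold conjVec
  fun_prop

theorem dot_conjVec (u v : EuclideanSpace ℂ (Fin 2)) :
    dot (conjVec u) (conjVec v) = star (dot u v) := by
  simp [dot]

theorem inner_eq_dot (u v : EuclideanSpace ℂ (Fin 2)) : inner ℂ u v = dot (conjVec u) v := by
  simp [PiLp.inner_apply, Fin.sum_univ_two, dot, mul_comm]

theorem memLp_conjVec {f : ℝ → EuclideanSpace ℂ (Fin 2)}
    (hf : MemLp f 2 (volume.restrict (Icc a b))) :
    MemLp (fun x => conjVec (f x)) 2 (volume.restrict (Icc a b)) :=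
  (memLp_congr_norm hf.1 (continuous_conjVec.comp_aestronglyMeasurable hf.1)
    (Eventually.of_forall fun _ => (norm_conjVec _).symm)).1 hf

/-- Complex conjugation on `L²([a, b], ℂ²)`. -/
def conjL2 (f : L2 a b) : L2 a b := (memLp_conjVec (Lp.memLp f)).toLp

theorem coeFn_conjL2 (f : L2 a b) :
    conjL2 f =ᵐ[volume.restrict (Icc a b)] fun x => conjVec (f x) :=
  (memLp_conjVec (Lp.memLp f)).coeFn_toLp

theorem inner_toLp_left {u : ℝ → EuclideanSpace ℂ (Fin 2)}
    (hu : MemLp u 2 (volume.restrict (Icc a b))) (f : L2 a b) :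
    inner ℂ hu.toLp f = ∫ x in Icc a b, dot (conjVec (u x)) (f x) := by
  rw [L2.inner_def]
  refine integral_congr_ae ?_
  filter_upwards [hu.coeFn_toLp] with x hx
  rw [hx, inner_eq_dot]

theorem inner_eq_integral_dot (f g : L2 a b) :
    inner ℂ f g = ∫ x in Icc a b, dot (conjL2 f x) (g x) := by
  rw [L2.inner_def]
  refine integral_congr_ae ?_
  filter_upwards [coeFn_conjL2 f] with x hx
  rw [hx, inner_eq_dot]

theorem IsResolvent.star_apply (hab : a ≤ b) {z : ℂ} {R : L2 a b →L[ℂ] L2 a b}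
    (hR : IsResolvent (T a b p q α) z R) (f : L2 a b) : star R f = conjL2 (R (conjL2 f)) := by
  refine ext_inner_right ℂ fun g => ?_
  rw [ContinuousLinearMap.star_eq_adjoint, ContinuousLinearMap.adjoint_inner_left,
    inner_eq_integral_dot, ← hR.integral_dot_comm hab, inner_eq_integral_dot]
  refine integral_congr_ae ?_
  filter_upwards [coeFn_conjL2 (conjL2 (R (conjL2 f))), coeFn_conjL2 (R (conjL2 f))] with x h1 h2
  rw [h1, h2, conjVec_conjVec]

end Conjugation

/-! ### The kernels of the resolvent and of its adjoint -/

section Green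

open Filter Topology

variable {a b : ℝ} {p q : ℝ → ℝ} {α : ℝ}

theorem exists_norm_greenRow_le (hab : a ≤ b) (hp : IntegrableOn p (Icc a b))
    (hq : IntegrableOn q (Icc a b)) (α : ℝ) (z : ℂ) (k : Fin 2) (x : ℝ) :
    ∃ C, ∀ y ∈ Icc a b, ‖greenRow a b p q α z x k y‖ ≤ C := by
  obtain ⟨C, hC⟩ := isCompact_Icc.exists_bound_of_continuousOn
    ((continuousOn_fundamentalCol hab hp hq 1 z).const_smul
      (-(rightSol a b p q α z x k) / c a b p q α z))
  obtain ⟨D, hD⟩ := isCompact_Icc.exists_bound_of_continuousOn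
    ((continuousOn_rightSol (α := α) hab hp hq z).const_smul
      (-(fundamentalCol a b p q 1 z x k) / c a b p q α z))
  refine ⟨max C D, fun y hy => ?_⟩
  unfold greenRow
  split_ifs
  · exact (hC y hy).trans (le_max_left _ _)
  · exact (hD y hy).trans (le_max_right _ _)

theorem memLp_greenRow (hab : a ≤ b) (hp : IntegrableOn p (Icc a b))
    (hq : IntegrableOn q (Icc a b)) (α : ℝ) (z : ℂ) (x : ℝ) (k : Fin 2) :
    MemLp (greenRow a b p q α z x k) 2 (volume.restrict (Icc a b)) := by
  obtain ⟨C, hC⟩ := exists_norm_greenRow_le hab hp hq α z k x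
  refine MemLp.of_bound ?_ C ((ae_restrict_iff' measurableSet_Icc).2 (Eventually.of_forall hC))
  refine AEStronglyMeasurable.piecewise (s := Iic x) measurableSet_Iic ?_ ?_
  · exact (((continuousOn_fundamentalCol hab hp hq 1 z).aestronglyMeasurable
      measurableSet_Icc).const_smul (-(rightSol a b p q α z x k) / c a b p q α z)).restrict
  · exact (((continuousOn_rightSol (α := α) hab hp hq z).aestronglyMeasurable
      measurableSet_Icc).const_smul (-(fundamentalCol a b p q 1 z x k) / c a b p q α z)).restrict

theorem exists_uniform_norm_greenRow_le (hab : a ≤ b) (hp : IntegrableOn p (Icc a b))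
    (hq : IntegrableOn q (Icc a b)) (α : ℝ) (z : ℂ) :
    ∃ C, ∀ x ∈ Icc a b, ∀ k, ∀ y ∈ Icc a b, ‖greenRow a b p q α z x k y‖ ≤ C := by
  obtain ⟨C, hC⟩ := isCompact_Icc.exists_bound_of_continuousOn
    (continuousOn_fundamentalCol hab hp hq 1 z)
  obtain ⟨D, hD⟩ := isCompact_Icc.exists_bound_of_continuousOn
    (continuousOn_rightSol (α := α) hab hp hq z)
  refine ⟨C * D / ‖c a b p q α z‖, fun x hx k y hy => ?_⟩
  have h1 := fun x hx => (PiLp.norm_apply_le (fundamentalCol a b p q 1 z x) k).trans (hC x hx)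
  have h2 := fun x hx => (PiLp.norm_apply_le (rightSol a b p q α z x) k).trans (hD x hx)
  have hC0 := (norm_nonneg _).trans (hC x hx)
  have hD0 := (norm_nonneg _).trans (hD x hx)
  unfold greenRow
  split_ifs
  · rw [norm_smul, norm_div, norm_neg, div_mul_eq_mul_div, mul_comm C]
    gcongr
    exacts [h2 x hx, hC y hy]
  · rw [norm_smul, norm_div, norm_neg, div_mul_eq_mul_div]
    gcongr
    exacts [h1 x hx, hD y hy]

theorem exists_norm_toLp_le {u : ℝ → Fin 2 → ℝ → EuclideanSpace ℂ (Fin 2)} {C : ℝ}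
    (hu : ∀ x k, MemLp (u x k) 2 (volume.restrict (Icc a b)))
    (h : ∀ x ∈ Icc a b, ∀ k, ∀ y ∈ Icc a b, ‖u x k y‖ ≤ C) :
    ∃ D : ℝ, ∀ᵐ x ∂(volume.restrict (Icc a b)), ∀ k, ‖(hu x k).toLp‖ ≤ D := by
  refine ⟨measureUnivNNReal (volume.restrict (Icc a b)) ^ (ENNReal.toReal 2)⁻¹ * max C 0, ?_⟩
  have hm : ∀ᵐ x ∂(volume.restrict (Icc a b)), x ∈ Icc a b := ae_restrict_mem measurableSet_Icc
  filter_upwards [hm] with x hx k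
  refine Lp.norm_le_of_ae_bound (le_max_right _ _) ?_
  filter_upwards [hm, (hu x k).coeFn_toLp] with y hy h1
  rw [h1]
  exact (h x hx k y hy).trans (le_max_left _ _)

theorem IsResolvent.exists_hasRowKernel (hab : a < b) (hp : IntegrableOn p (Icc a b))
    (hq : IntegrableOn q (Icc a b)) {z : ℂ} {R : L2 a b →L[ℂ] L2 a b}
    (hR : IsResolvent (T a b p q α) z R) :
    ∃ C, HasRowKernel R
      (fun x k => (memLp_conjVec (memLp_greenRow hab.le hp hq α z x k)).toLp) C := by
  obtain ⟨C, hC⟩ := exists_uniform_norm_greenRow_le hab.le hp hq α z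
  obtain ⟨D, hD⟩ := exists_norm_toLp_le
    (fun x k => memLp_conjVec (memLp_greenRow hab.le hp hq α z x k))
    (fun x hx k y hy => (norm_conjVec _).trans_le (hC x hx k y hy))
  refine ⟨D, fun f => ?_, hD⟩
  filter_upwards [hR.apply_eq_integral hab hp hq f] with x hx k
  rw [hx k, inner_toLp_left]
  simp only [conjVec_conjVec]

/-- By `IsResolvent.star_apply` the adjoint has the conjugated kernel; the conjugation built into
the inner product then leaves the Green rows themselves. -/
theorem IsResolvent.exists_hasRowKernel_star (hab : a < b) (hp : IntegrableOn p (Icc a b))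
    (hq : IntegrableOn q (Icc a b)) {z : ℂ} {R : L2 a b →L[ℂ] L2 a b}
    (hR : IsResolvent (T a b p q α) z R) :
    ∃ C, HasRowKernel (star R) (fun x k => (memLp_greenRow hab.le hp hq α z x k).toLp) C := by
  obtain ⟨C, hC⟩ := exists_uniform_norm_greenRow_le hab.le hp hq α z
  obtain ⟨D, hD⟩ := exists_norm_toLp_le (fun x k => memLp_greenRow hab.le hp hq α z x k) hC
  refine ⟨D, fun f => ?_, hD⟩
  rw [hR.star_apply hab.le]
  filter_upwards [hR.apply_eq_integral hab hp hq (conjL2 f), coeFn_conjL2 (R (conjL2 f))]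
    with x hx h1 k
  rw [h1, conjVec_apply, hx k, inner_toLp_left, ← starRingEnd_apply, ← integral_conj]
  refine integral_congr_ae ?_
  filter_upwards [coeFn_conjL2 f] with y hy
  rw [hy, starRingEnd_apply, ← dot_conjVec, conjVec_conjVec]

/-- Used with `u = φ` and `v = ψ` at two parameters: the left side is what Lagrange's identity
leaves at `x`, and on the right the Wronskians become `c z` and `c w`, so that division by `c z * c
w` separates the parameters. -/
theorem wronskian_identity (u₁ u₂ v₁ v₂ : EuclideanSpace ℂ (Fin 2)) :
    dot v₁ v₂ * wronskian u₁ u₂ - dot u₁ u₂ * wronskian v₁ v₂ =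
      wronskian u₁ v₁ * dot u₂ v₂ - wronskian u₂ v₂ * dot u₁ v₁ := by
  simp only [dot, wronskian]
  ring

theorem sub_mul_sum_integral_greenRow (hab : a ≤ b) (hp : IntegrableOn p (Icc a b))
    (hq : IntegrableOn q (Icc a b)) {z w : ℂ} (hz : c a b p q α z ≠ 0) (hw : c a b p q α w ≠ 0)
    {x : ℝ} (hx : x ∈ Icc a b) :
    (z - w) * ∑ k, ∫ y in Icc a b, dot (greenRow a b p q α w x k y) (greenRow a b p q α z x k y) =
      dot (fundamentalCol a b p q 1 w x) (rightSol a b p q α w x) / c a b p q α w -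
      dot (fundamentalCol a b p q 1 z x) (rightSol a b p q α z x) / c a b p q α z := by
  have hφ := fun z => continuousOn_fundamentalCol hab hp hq 1 z
  have hψ := fun z => continuousOn_rightSol (α := α) hab hp hq z
  have i1 := integrableOn_dot (hφ z) ((hφ w).integrableOn_compact isCompact_Icc)
  have i2 := integrableOn_dot (hψ z) ((hψ w).integrableOn_compact isCompact_Icc)
  have h1 : ∀ k, ∫ y in Icc a b,
      dot (greenRow a b p q α w x k y) (greenRow a b p q α z x k y) =
      (rightSol a b p q α w x k * rightSol a b p q α z x k) / (c a b p q α w * c a b p q α z) *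
        (∫ y in a..x, dot (fundamentalCol a b p q 1 z y) (fundamentalCol a b p q 1 w y)) +
      (fundamentalCol a b p q 1 w x k * fundamentalCol a b p q 1 z x k) /
        (c a b p q α w * c a b p q α z) *
        ∫ y in x..b, dot (rightSol a b p q α z y) (rightSol a b p q α w y) := fun k => by
    rw [← intervalIntegral.integral_const_mul, ← intervalIntegral.integral_const_mul,
      ← setIntegral_ite_le (i1.const_mul _) (i2.const_mul _) hx]
    refine integral_congr_ae (Eventually.of_forall fun y => ?_)
    simp only [greenRow]
    split_ifs
    · rw [smul_dot, dot_smul, dot_comm]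
      field_simp
    · rw [smul_dot, dot_smul, dot_comm]
      field_simp
  have e1 := wronskian_eq_add_integral hab (absCont_fundamentalCol hab hp hq 1 z)
    (absCont_fundamentalCol hab hp hq 1 w) (diffExpr_fundamentalCol hab hp hq 1 z)
    (diffExpr_fundamentalCol hab hp hq 1 w) (left_mem_Icc.2 hab) hx
  have e2 := wronskian_eq_add_integral (p := p) (q := q) hab (absCont_rightSol (α := α) hab hp hq z)
    (absCont_rightSol (α := α) hab hp hq w) (diffExpr_rightSol hab hp hq z)
    (diffExpr_rightSol hab hp hq w) hx (right_mem_Icc.2 hab)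
  have e3 : wronskian (fundamentalCol a b p q 1 z a) (fundamentalCol a b p q 1 w a) = 0 := by
    simp [wronskian, fundamentalCol_left hab hp hq]
  have e4 : wronskian (rightSol a b p q α z b) (rightSol a b p q α w b) = 0 := by
    simp only [wronskian, (rightSol_right hab hp hq _).1, (rightSol_right hab hp hq _).2]
    ring
  have e5 := wronskian_rightSol (α := α) hab hp hq z hx
  have e6 := wronskian_rightSol (α := α) hab hp hq w hx
  have e7 := wronskian_identity (fundamentalCol a b p q 1 z x) (fundamentalCol a b p q 1 w x)
    (rightSol a b p q α z x) (rightSol a b p q α w x)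
  rw [e3, sub_zero] at e1
  rw [e4, zero_sub] at e2
  rw [e5, e6] at e7
  -- The Wronskians at `a` and `b` being zero, `e1` and `e2` now evaluate the two partial integrals
  -- by Wronskians at `x`, of opposite sign, and `e7` combines them.
  rw [Fin.sum_univ_two, h1, h1]
  field_simp
  simp only [dot] at e7 e1 e2 ⊢
  linear_combination e7 -
    (rightSol a b p q α z x 0 * rightSol a b p q α w x 0 +
      rightSol a b p q α z x 1 * rightSol a b p q α w x 1) * e1 -
    (fundamentalCol a b p q 1 z x 0 * fundamentalCol a b p q 1 w x 0 +
      fundamentalCol a b p q 1 z x 1 * fundamentalCol a b p q 1 w x 1) * e2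

end Green

/-! ### The trace formula -/

theorem HasTrace.smul {H : Type*} [NormedAddCommGroup H] [InnerProductSpace ℂ H] [CompleteSpace H]
    {A : H →L[ℂ] H} {t : ℂ} (h : HasTrace A t) (s : ℂ) : HasTrace (s • A) (s * t) := by
  refine ⟨fun ι e => ?_, fun ι e => ?_⟩
  · have h1 := (h.1 ι e).mul_left ‖s‖
    refine h1.congr fun i => ?_
    rw [CFC.abs_smul, _root_.smul_apply, inner_smul_right_eq_smul]
    simp
  · have h1 := (h.2 ι e).mul_left s
    simpa only [_root_.smul_apply, inner_smul_right] using h1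

end DiracKrein

end

theorem proposition3p4 (a b : ℝ) (hab : a < b) (p q : ℝ → ℝ)
    (hp : IntegrableOn p (Icc a b)) (hq : IntegrableOn q (Icc a b))
    (α : ℝ) (hα : α ∈ Ico 0 Real.pi) (z₁ z₂ : ℂ)
    (hz₁ : z₁ ∈ DiracKrein.resolventSet (DiracKrein.T a b p q α))
    (hz₂ : z₂ ∈ DiracKrein.resolventSet (DiracKrein.T a b p q α)) :
    Differentiable ℂ (DiracKrein.c a b p q α) ∧
    DiracKrein.c a b p q α z₁ ≠ 0 ∧
    DiracKrein.c a b p q α z₂ ≠ 0 ∧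
    DiracKrein.HasTrace
      (DiracKrein.resolvent (DiracKrein.T a b p q α) z₁ -
        DiracKrein.resolvent (DiracKrein.T a b p q α) z₂)
      (-(deriv (DiracKrein.c a b p q α) z₁ / DiracKrein.c a b p q α z₁) +
        deriv (DiracKrein.c a b p q α) z₂ / DiracKrein.c a b p q α z₂) := by
  open DiracKrein in
  have hR₁ := resolvent_spec hz₁
  have hR₂ := resolvent_spec hz₂
  have hc₁ := c_ne_zero hab hp hq hR₁
  have hc₂ := c_ne_zero hab hp hq hR₂
  refine ⟨fun z => (hasDerivAt_c hab.le hp hq z).differentiableAt, hc₁, hc₂, ?_⟩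
  -- The trace lemma concerns `star S * R`; taking `S` to be the adjoint of the first resolvent
  -- yields the product in the resolvent identity.
  obtain ⟨C, hC⟩ := hR₁.exists_hasRowKernel_star hab hp hq
  obtain ⟨D, hD⟩ := hR₂.exists_hasRowKernel hab hp hq
  have h := (hC.hasTrace hD).smul (z₁ - z₂)
  rw [star_star, ← hR₁.sub_eq hR₂] at h
  convert h using 1
  -- Both sides become integrals over the same `x`, and the integrands agree pointwise.
  rw [(hasDerivAt_c hab.le hp hq z₁).deriv, (hasDerivAt_c hab.le hp hq z₂).deriv,
    intervalIntegral.integral_of_le hab.le, intervalIntegral.integral_of_le hab.le,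
    ← integral_Icc_eq_integral_Ioc, ← integral_Icc_eq_integral_Ioc, ← integral_div, ← integral_div,
    neg_add_eq_sub, ← integral_sub, ← integral_const_mul]
  · refine setIntegral_congr_fun measurableSet_Icc fun x hx => ?_
    rw [← sub_mul_sum_integral_greenRow hab.le hp hq hc₁ hc₂ hx]
    congr 1
    refine Finset.sum_congr rfl fun k _ => ?_
    rw [inner_toLp_left]
    refine integral_congr_ae ?_
    filter_upwards [(memLp_greenRow hab.le hp hq α z₁ x k).coeFn_toLp] with y hy
    rw [hy, conjVec_conjVec]
  · exact (integrableOn_dot (continuousOn_fundamentalCol hab.le hp hq 1 z₂)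
      ((continuousOn_rightSol hab.le hp hq z₂).integrableOn_compact isCompact_Icc)).div_const _
  · exact (integrableOn_dot (continuousOn_fundamentalCol hab.le hp hq 1 z₁)
      ((continuousOn_rightSol hab.le hp hq z₁).integrableOn_compact isCompact_Icc)).div_const _
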